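/- Let $d\ge 3$ and let $V:\mathbb R^d\to[0,\infty)$ be locally integrable, not a.e. zero, and in the reverse Hölder class $RH_s$ for some $s\in[d/2,\infty]$, i.e. for some constant $c>0$, $\big(\frac1{|B|}\int_B V^s\big)^{1/s}\le \frac{c}{|B|}\int_B V$ for all balls $B$ (the left side being $\operatorname{ess\,sup}_B V$ if $s=\infty$). For $x\in\mathbb R^d$ put $$\rho(x)=\sup\Big\{r>0:\ \frac1{r^{d-2}}\int_{B(x,r)}V(y)\,dy\le 1\Big\}.$$ *Notation.* A weight is a nonnegative locally integrable function on $\mathbb R^d$ that is not a.e. zero, and $\omega(B)=\int_B\omega$. For $1\le p<\infty$ and $\theta>0$, $\omega\in A_p^{\rho,\theta}$ means that $\omega$ is a weight and that for some constant $c>0$ and all balls $B=B(x_0,r)$, if $p>1$ and $p'=p/(p-1)$, $$\Big(\frac1{|B|}\int_B\omega\Big)^{1/p}\Big(\frac1{|B|}\int_B\omega^{-p'/p}\Big)^{1/p'}\le c\Big(1+\frac r{\rho(x_0)}\Big)^{\theta},$$ and, if $p=1$, $\frac1{|B|}\int_B\omega\le c\,(1+\frac r{\rho(x_0)})^{\theta}\operatorname{ess\,inf}_B\omega$.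 Its characteristic $[\omega]_{A_p^{\rho,\theta}}$ is $$\sup_{B}\Big(1+\frac r{\rho(x_0)}\Big)^{-\theta}\Big(\frac1{|B|}\int_B\omega\Big)^{1/p}\Big(\frac1{|B|}\int_B\omega^{-p'/p}\Big)^{1/p'}\ (p>1),\qquad \sup_{B}\Big(1+\frac r{\rho(x_0)}\Big)^{-\theta}\Big(\frac1{|B|}\int_B\omega\Big)\big(\operatorname{ess\,inf}_B\omega\big)^{-1}\ (p=1).$$ For $0<\beta<1$ and $\theta>0$, $\mathcal C^{\beta,*}_{\rho,\theta}$ is the set of locally integrable $f:\mathbb R^d\to\mathbb R$ with $$\|f\|_{\mathcal C^{\beta,*}_{\rho,\theta}}=\sup_{B=B(x_0,r)}\Big(1+\frac r{\rho(x_0)}\Big)^{-\theta}\frac1{|B|^{1+\beta/d}}\int_B\Big[f(x)-\operatorname*{ess\,inf}_{B}f\Big]dx<\infty .$$ **Theorem.** There are constants $C_0\ge1$ and $N_0>0$ such that for all $x,y\in\mathbb R^d$ $$\frac1{C_0}\Big(1+\frac{|x-y|}{\rho(x)}\Big)^{-N_0}\le\frac{\rho(y)}{\rho(x)}\le C_0\Big(1+\frac{|x-y|}{\rho(x)}\Big)^{\frac{N_0}{N_0+1}}.\qquad(*)$$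 Fix any $C_0\ge1$, $N_0>0$ satisfying $(*)$, and let $0<\beta<1$ and $\theta_1>0$. (1) There is a constant $C>0$, depending only on $d,V,C_0,N_0,\beta,\theta_1$, such that for all $1\le p<\infty$, $\theta_2>0$, $\omega\in A_p^{\rho,\theta_2}$, $f\in\mathcal C^{\beta,*}_{\rho,\theta_1}$ and all balls $B=B(x_0,r)$, $$\frac1{|B|^{\beta/d}}\Big(\frac1{\omega(B)}\int_B\Big[f(x)-\operatorname*{ess\,inf}_{B}f\Big]^p\omega(x)\,dx\Big)^{1/p}\le C\,[\omega]_{A_p^{\rho,\theta_2}}\Big(1+\frac r{\rho(x_0)}\Big)^{(N_0+1)\theta_1}\|f\|_{\mathcal C^{\beta,*}_{\rho,\theta_1}} .$$ (2) Conversely, let $1\le p<\infty$, $\theta_2>0$, $\omega\in A_p^{\rho,\theta_2}$, let $f:\mathbb R^d\to\mathbb R$ be measurable, and let $C>0$ be a constant such that for all balls $B=B(x_0,r)$ $$\frac1{|B|^{\beta/d}}\Big(\frac1{\omega(B)}\int_B\Big[f(x)-\operatorname*{ess\,inf}_{B}f\Big]^p\omega(x)\,dx\Big)^{1/p}\le C\,[\omega]_{A_p^{\rho,\theta_2}}\Big(1+\frac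 r{\rho(x_0)}\Big)^{\theta_1-\theta_2}.$$ Then $f\in\mathcal C^{\beta,*}_{\rho,\theta_1}$ and $\|f\|_{\mathcal C^{\beta,*}_{\rho,\theta_1}}\le C'\,[\omega]_{A_p^{\rho,\theta_2}}$ with $C'=C\,[\omega]_{A_p^{\rho,\theta_2}}$. -/

import Mathlib

open MeasureTheory Metric
open scoped ENNReal

/-- The average `|B|⁻¹ ∫_B g` over the ball `B = B(x₀, r)`. -/
noncomputable def ballAverage {d : ℕ} (x₀ : EuclideanSpace ℝ (Fin d)) (r : ℝ)
    (g : EuclideanSpace ℝ (Fin d) → ℝ≥0∞) : ℝ≥0∞ :=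
  (volume (ball x₀ r))⁻¹ * ∫⁻ x in ball x₀ r, g x

/-- `V` satisfies the reverse Hölder inequality with exponent `s` on all balls of `ℝ^d`
(for `s = ∞` the `L^s`-average is the essential supremum). -/
def ReverseHolder {d : ℕ} (s : ℝ≥0∞) (V : EuclideanSpace ℝ (Fin d) → ℝ) : Prop :=
  ∃ C : ℝ, 0 < C ∧ ∀ (x₀ : EuclideanSpace ℝ (Fin d)) (r : ℝ), 0 < r →
    (if s = ∞ then essSup (fun y => ENNReal.ofReal (V y)) (volume.restrict (ball x₀ r))
      else (ballAverage x₀ r fun y => ENNReal.ofReal (V y) ^ s.toReal) ^ (1 / s.toReal))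
    ≤ ENNReal.ofReal C * ballAverage x₀ r fun y => ENNReal.ofReal (V y)

/-- A potential on `ℝ^d`: nonnegative, locally integrable, not (a.e.) identically zero, and in
the reverse Hölder class `RH_s` for some `d/2 ≤ s ≤ ∞`. -/
structure IsPotential {d : ℕ} (V : EuclideanSpace ℝ (Fin d) → ℝ) : Prop where
  nonneg : ∀ x, 0 ≤ V x
  locallyIntegrable : LocallyIntegrable V volume
  ne_zero : ¬ V =ᵐ[volume] 0
  reverseHolder : ∃ s : ℝ≥0∞, (d : ℝ≥0∞) / 2 ≤ s ∧ ReverseHolder s V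

/-- The critical radius function
`ρ(x) = sup {r > 0 : r^{-(d-2)} ∫_{B(x,r)} V ≤ 1}` (used for `d ≥ 3` only). -/
noncomputable def criticalRadius {d : ℕ} (V : EuclideanSpace ℝ (Fin d) → ℝ)
    (x : EuclideanSpace ℝ (Fin d)) : ℝ :=
  sSup {r : ℝ | 0 < r ∧ 1 / r ^ (d - 2) * ∫ y in ball x r, V y ≤ 1}

/-- `C₀ ≥ 1` and `N₀ > 0` are constants for which the comparison inequality
`C₀⁻¹ (1 + |x-y|/ρ(x))^{-N₀} ≤ ρ(y)/ρ(x) ≤ C₀ (1 + |x-y|/ρ(x))^{N₀/(N₀+1)}` holds. -/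
def IsComparisonPair {d : ℕ} (ρ : EuclideanSpace ℝ (Fin d) → ℝ) (C₀ N₀ : ℝ) : Prop :=
  1 ≤ C₀ ∧ 0 < N₀ ∧ ∀ x y : EuclideanSpace ℝ (Fin d),
    1 / C₀ * (1 + dist x y / ρ x) ^ (-N₀) ≤ ρ y / ρ x ∧
    ρ y / ρ x ≤ C₀ * (1 + dist x y / ρ x) ^ (N₀ / (N₀ + 1))

/-- A weight: nonnegative, locally integrable, and not (a.e.) identically zero. -/
structure IsWeight {d : ℕ} (ω : EuclideanSpace ℝ (Fin d) → ℝ) : Prop where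
  nonneg : ∀ x, 0 ≤ ω x
  locallyIntegrable : LocallyIntegrable ω volume
  ne_zero : ¬ ω =ᵐ[volume] 0

/-- The class `A_p^{ρ,θ}`, `1 ≤ p < ∞`. Here `0 ^ (-a) = ∞` for `a > 0`, and
`p.conjExponent = p / (p - 1)`. -/
def IsApWeight {d : ℕ} (ρ : EuclideanSpace ℝ (Fin d) → ℝ) (θ p : ℝ)
    (ω : EuclideanSpace ℝ (Fin d) → ℝ) : Prop :=
  IsWeight ω ∧ ∃ C : ℝ, 0 < C ∧ ∀ (x₀ : EuclideanSpace ℝ (Fin d)) (r : ℝ), 0 < r →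
    if p = 1 then
      (ballAverage x₀ r fun x => ENNReal.ofReal (ω x))
        ≤ ENNReal.ofReal (C * (1 + r / ρ x₀) ^ θ)
          * essInf (fun x => ENNReal.ofReal (ω x)) (volume.restrict (ball x₀ r))
    else
      (ballAverage x₀ r fun x => ENNReal.ofReal (ω x)) ^ (1 / p)
        * (ballAverage x₀ r fun x => ENNReal.ofReal (ω x) ^ (-(p.conjExponent / p)))
            ^ (1 / p.conjExponent)
      ≤ ENNReal.ofReal (C * (1 + r / ρ x₀) ^ θ)

/-- The characteristic constant `[ω]` of the class `A_p^{ρ,θ}`. -/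
noncomputable def apCharacteristic {d : ℕ} (ρ : EuclideanSpace ℝ (Fin d) → ℝ) (θ p : ℝ)
    (ω : EuclideanSpace ℝ (Fin d) → ℝ) : ℝ≥0∞ :=
  ⨆ (x₀ : EuclideanSpace ℝ (Fin d)) (r : ℝ) (_ : 0 < r),
    ENNReal.ofReal ((1 + r / ρ x₀) ^ (-θ)) *
      (if p = 1 then
        (ballAverage x₀ r fun x => ENNReal.ofReal (ω x))
          * (essInf (fun x => ENNReal.ofReal (ω x)) (volume.restrict (ball x₀ r)))⁻¹
      else
        (ballAverage x₀ r fun x => ENNReal.ofReal (ω x)) ^ (1 / p)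
          * (ballAverage x₀ r fun x => ENNReal.ofReal (ω x) ^ (-(p.conjExponent / p)))
              ^ (1 / p.conjExponent))

/-- The lower oscillation `f(x) - ess inf_B f`, a nonnegative number for a.e. `x ∈ B`. The
essential infimum is taken in `[-∞, ∞]`, so this is `∞` if `f` is not essentially bounded below
on `B`. -/
noncomputable def lowerOsc {d : ℕ} (f : EuclideanSpace ℝ (Fin d) → ℝ)
    (B : Set (EuclideanSpace ℝ (Fin d))) (x : EuclideanSpace ℝ (Fin d)) : ℝ≥0∞ :=
  ((f x : EReal) - essInf (fun y => (f y : EReal)) (volume.restrict B)).toENNReal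

/-- The constant `‖f‖` of the space `C^{β,*}_{ρ,θ}`:
`sup_B (1 + r/ρ(x₀))^{-θ} |B|^{-(1+β/d)} ∫_B [f - ess inf_B f]`. -/
noncomputable def campanatoConst {d : ℕ} (ρ : EuclideanSpace ℝ (Fin d) → ℝ) (β θ : ℝ)
    (f : EuclideanSpace ℝ (Fin d) → ℝ) : ℝ≥0∞ :=
  ⨆ (x₀ : EuclideanSpace ℝ (Fin d)) (r : ℝ) (_ : 0 < r),
    ENNReal.ofReal ((1 + r / ρ x₀) ^ (-θ)) *
      (volume (ball x₀ r) ^ (-(1 + β / d)) * ∫⁻ x in ball x₀ r, lowerOsc f (ball x₀ r) x)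

/-- Membership in the space `C^{β,*}_{ρ,θ}`. -/
def MemCampanato {d : ℕ} (ρ : EuclideanSpace ℝ (Fin d) → ℝ) (β θ : ℝ)
    (f : EuclideanSpace ℝ (Fin d) → ℝ) : Prop :=
  LocallyIntegrable f volume ∧ campanatoConst ρ β θ f < ∞

/-- `|B|^{-β/d} (ω(B)^{-1} ∫_B [f - ess inf_B f]^p ω)^{1/p}` for the ball `B = B(x₀, r)`. -/
noncomputable def weightedOsc {d : ℕ} (β p : ℝ) (ω f : EuclideanSpace ℝ (Fin d) → ℝ)
    (x₀ : EuclideanSpace ℝ (Fin d)) (r : ℝ) : ℝ≥0∞ :=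
  volume (ball x₀ r) ^ (-(β / d)) *
    ((∫⁻ x in ball x₀ r, ENNReal.ofReal (ω x))⁻¹ *
      ∫⁻ x in ball x₀ r, lowerOsc f (ball x₀ r) x ^ p * ENNReal.ofReal (ω x)) ^ (1 / p)

/-! The proof has three independent ingredients: size estimates for `V`, a pointwise oscillation
bound for Campanato functions, and Hölder's inequality against an `A_p` weight.

Comparison of critical radii. By Jensen the exponent `s` may be lowered to `d/2`. Put `v = V dx` and
`w = V ^ (d/2) dx`. Hölder and reverse Hölder together make sets of small relative volume carry at
most half of the `v`-mass of a ball. Applied to thin annuli this makes `v` doubling; applied to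
small inner balls it gives power decay of `w`. At the exponent `d/2` the scaled mass `r ^ (2 - d)
v(B(x, r))` is comparable to `w(B(x, r)) ^ (2/d)`, so it inherits the decay and no self-improvement
of the reverse Hölder class is needed. Decay makes `ρ` finite and positive; decay with doubling
gives the lower bound for `ρ(y)/ρ(x)`, and exchanging `x` and `y` gives the upper one.

Part (1). The essential infima over the balls `B(x, r / 2 ^ k)` increase by geometrically decreasing
amounts, so Lebesgue differentiation bounds `f(x) - ess inf` pointwise a.e. (`MemCampanato.ae_le`).
Recentring at the points of a given ball costs the factor `N₀ + 1` in the exponent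
(`MemCampanato.ae_lowerOsc_le`). An `L^∞` bound passes to every weighted mean, so the weight enters
only through `[ω] ≥ 1`.

Part (2). Hölder (`IsApWeight.ballAverage_le`) bounds the plain mean of the oscillation by the
weighted one times the `A_p` quantity of the ball, and the powers of `1 + r/ρ` cancel. -/

/-! ### Power growth and decay from one-step inequalities -/

/-- Iterate the one-step inequality from `R` down to scale `r`. The exponent is chosen before `φ`,
so that it is later uniform in the centre of the balls. -/
lemma exists_growth_exponent {A l : ℝ} (hA : 1 < A) (hl0 : 0 < l) (hl : l < 1) :
    ∃ m : ℝ, 0 < m ∧ ∀ φ : ℝ → ℝ, (∀ r, 0 ≤ φ r) → Monotone φ →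
      (∀ r, 0 < r → φ r ≤ A * φ (l * r)) →
      ∀ r R, 0 < r → r ≤ R → φ R ≤ A * (R / r) ^ m * φ r := by
  have hl1 : 1 < l⁻¹ := (one_lt_inv₀ hl0).2 hl
  refine ⟨Real.logb l⁻¹ A, Real.logb_pos hl1 hA, fun φ h0 hmono hstep r R hr hrR => ?_⟩
  have hR : 0 < R := hr.trans_le hrR
  have hAm : (l⁻¹) ^ Real.logb l⁻¹ A = A :=
    Real.rpow_logb (by positivity) hl1.ne' (by positivity)
  -- Here `l ^ (k + 1) < r / R ≤ l ^ k`: the iteration takes `k + 1` steps but only `k` are absorbed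
  -- by the power, which leaves the factor `A`.
  obtain ⟨k, hk1, hk2⟩ := exists_nat_pow_near_of_lt_one (div_pos hr hR)
    ((div_le_one hR).2 hrR) hl0 hl
  have hit : ∀ n : ℕ, φ R ≤ A ^ n * φ (l ^ n * R) := by
    intro n
    induction n with
    | zero => simp
    | succ n ih =>
      calc φ R ≤ A ^ n * φ (l ^ n * R) := ih
        _ ≤ A ^ n * (A * φ (l * (l ^ n * R))) := by
          gcongr
          exact hstep _ (by positivity)
        _ = A ^ (n + 1) * φ (l ^ (n + 1) * R) := by
          rw [show l ^ (n + 1) * R = l * (l ^ n * R) by ring]; ring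
  have hpow : A ^ k ≤ (R / r) ^ Real.logb l⁻¹ A := by
    calc A ^ k = ((l⁻¹) ^ k) ^ Real.logb l⁻¹ A := by
          conv_lhs => rw [← hAm]
          rw [← Real.rpow_natCast, ← Real.rpow_natCast, ← Real.rpow_mul (by positivity),
            ← Real.rpow_mul (by positivity), mul_comm]
      _ ≤ (R / r) ^ Real.logb l⁻¹ A := by
          refine Real.rpow_le_rpow (by positivity) ?_ (Real.logb_pos hl1 hA).le
          rw [inv_pow, inv_le_comm₀ (by positivity) (by positivity), inv_div]
          exact hk2
  calc φ R ≤ A ^ (k + 1) * φ (l ^ (k + 1) * R) := hit _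
    _ ≤ A ^ (k + 1) * φ r := by
      gcongr
      exact hmono ((lt_div_iff₀ hR).1 hk1).le
    _ = A * A ^ k * φ r := by ring
    _ ≤ _ := by
      have := h0 r
      gcongr

/-- Dual iteration: only `k` full contractions fit between `r` and `R`, and completing them to `k +
1` costs the factor `a⁻¹`. -/
lemma exists_decay_exponent {a ε : ℝ} (ha0 : 0 < a) (ha : a < 1) (he0 : 0 < ε) (he : ε < 1) :
    ∃ δ : ℝ, 0 < δ ∧ ∀ φ : ℝ → ℝ, (∀ r, 0 ≤ φ r) → Monotone φ →
      (∀ r, 0 < r → φ (ε * r) ≤ a * φ r) →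
      ∀ r R, 0 < r → r ≤ R → φ r ≤ a⁻¹ * (r / R) ^ δ * φ R := by
  have hd : 0 < Real.logb ε a := Real.logb_pos_of_base_lt_one he0 he ha0 ha
  refine ⟨Real.logb ε a, hd, fun φ h0 hmono hstep r R hr hrR => ?_⟩
  have hR : 0 < R := hr.trans_le hrR
  have hAm : ε ^ Real.logb ε a = a := Real.rpow_logb he0 he.ne ha0
  obtain ⟨k, hk1, hk2⟩ := exists_nat_pow_near_of_lt_one (div_pos hr hR)
    ((div_le_one hR).2 hrR) he0 he
  have hit : ∀ n : ℕ, φ (ε ^ n * R) ≤ a ^ n * φ R := by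
    intro n
    induction n with
    | zero => simp
    | succ n ih =>
      calc φ (ε ^ (n + 1) * R) = φ (ε * (ε ^ n * R)) := by congr 1; ring
        _ ≤ a * φ (ε ^ n * R) := hstep _ (by positivity)
        _ ≤ a * (a ^ n * φ R) := by gcongr
        _ = a ^ (n + 1) * φ R := by ring
  have hpow : a ^ (k + 1) ≤ (r / R) ^ Real.logb ε a := by
    calc a ^ (k + 1) = (ε ^ (k + 1)) ^ Real.logb ε a := by
          conv_lhs => rw [← hAm]
          rw [← Real.rpow_natCast, ← Real.rpow_natCast, ← Real.rpow_mul (by positivity),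
            ← Real.rpow_mul (by positivity), mul_comm]
      _ ≤ (r / R) ^ Real.logb ε a := Real.rpow_le_rpow (by positivity) hk1.le hd.le
  have hR0 := h0 R
  calc φ r ≤ φ (ε ^ k * R) := hmono ((div_le_iff₀ hR).1 hk2)
    _ ≤ a ^ k * φ R := hit k
    _ = a⁻¹ * a ^ (k + 1) * φ R := by field_simp; ring
    _ ≤ _ := by gcongr

/-! ### Pairs of measures with Hölder and reverse Hölder inequalities -/

lemma volumeReal_ball {d : ℕ} (x : EuclideanSpace ℝ (Fin d)) {r : ℝ} (hr : 0 < r) :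
    volume.real (ball x r) = r ^ d * volume.real (ball (0 : EuclideanSpace ℝ (Fin d)) 1) := by
  rw [measureReal_def, Measure.addHaar_ball_of_pos _ _ hr]
  simp [measureReal_def, hr.le]

lemma volumeReal_ball_pos {d : ℕ} (x : EuclideanSpace ℝ (Fin d)) {r : ℝ} (hr : 0 < r) :
    0 < volume.real (ball x r) :=
  ENNReal.toReal_pos (measure_ball_pos _ _ hr).ne' measure_ball_lt_top.ne

/-- Two measures, modelled on `v = g dx` and `w = g ^ q dx`, which satisfy Hölder's inequality on
bounded sets and the reverse Hölder inequality on balls. -/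
structure IsReverseHolderPair {d : ℕ} (v w : Measure (EuclideanSpace ℝ (Fin d)))
    (q C : ℝ) : Prop where
  one_lt : 1 < q
  one_le : 1 ≤ C
  finite_left : ∀ x r, v (ball x r) ≠ ∞
  finite_right : ∀ x r, w (ball x r) ≠ ∞
  holder : ∀ A x r, A ⊆ ball x r → MeasurableSet A →
    v.real A ≤ w.real A ^ (1 / q) * volume.real A ^ (1 - 1 / q)
  reverse : ∀ x r, 0 < r → w.real (ball x r) ^ (1 / q) ≤
    C * volume.real (ball x r) ^ (1 / q - 1) * v.real (ball x r)

namespace IsReverseHolderPair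

variable {d : ℕ} {v w : Measure (EuclideanSpace ℝ (Fin d))} {q C : ℝ}

lemma one_div_lt_one (h : IsReverseHolderPair v w q C) : 1 / q < 1 := by
  rw [div_lt_one (zero_lt_one.trans h.one_lt)]; exact h.one_lt

lemma monotone_left (h : IsReverseHolderPair v w q C) (x : EuclideanSpace ℝ (Fin d)) :
    Monotone fun r => v.real (ball x r) :=
  fun _ s hrs => measureReal_mono (ball_subset_ball hrs) (h.finite_left x s)

lemma monotone_right (h : IsReverseHolderPair v w q C) (x : EuclideanSpace ℝ (Fin d)) :
    Monotone fun r => w.real (ball x r) :=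
  fun _ s hrs => measureReal_mono (ball_subset_ball hrs) (h.finite_right x s)

/-- The `A_∞` property: Hölder on `A`, then reverse Hölder on the ball; the powers of the volume of
the ball cancel. -/
lemma measureReal_le (h : IsReverseHolderPair v w q C) {x : EuclideanSpace ℝ (Fin d)} {r : ℝ}
    (hr : 0 < r) {A : Set (EuclideanSpace ℝ (Fin d))} (hA : A ⊆ ball x r)
    (hAm : MeasurableSet A) {η : ℝ} (hη : 0 ≤ η)
    (hAη : volume.real A ≤ η * volume.real (ball x r)) :
    v.real A ≤ C * η ^ (1 - 1 / q) * v.real (ball x r) := by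
  have hB := volumeReal_ball_pos x hr
  have hq := h.one_div_lt_one
  have hq0 : 0 < q := zero_lt_one.trans h.one_lt
  have hC := h.one_le
  calc v.real A ≤ w.real A ^ (1 / q) * volume.real A ^ (1 - 1 / q) := h.holder A x r hA hAm
    _ ≤ w.real (ball x r) ^ (1 / q) * (η * volume.real (ball x r)) ^ (1 - 1 / q) := by
      have : 0 ≤ 1 - 1 / q := by linarith
      gcongr
      exact h.finite_right x r
    _ ≤ (C * volume.real (ball x r) ^ (1 / q - 1) * v.real (ball x r)) *
        (η * volume.real (ball x r)) ^ (1 - 1 / q) := by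
      gcongr
      exact h.reverse x r hr
    _ = C * η ^ (1 - 1 / q) * v.real (ball x r) *
        (volume.real (ball x r) ^ (1 / q - 1) * volume.real (ball x r) ^ (1 - 1 / q)) := by
      rw [Real.mul_rpow hη hB.le]; ring
    _ = _ := by
      rw [← Real.rpow_add hB]; simp

lemma exists_small (h : IsReverseHolderPair v w q C) :
    ∃ η : ℝ, 0 < η ∧ ∀ (x : EuclideanSpace ℝ (Fin d)) (r : ℝ), 0 < r →
      ∀ A ⊆ ball x r, MeasurableSet A → volume.real A ≤ η * volume.real (ball x r) →
        v.real (ball x r) ≤ 2 * v.real (ball x r \ A) := by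
  have hq := h.one_div_lt_one
  have hC := h.one_le
  have ht : 0 < 1 - 1 / q := by linarith
  -- This `η` solves `C * η ^ (1 - 1 / q) = 1 / 2`, so `A` holds at most half of the mass.
  refine ⟨(1 / (2 * C)) ^ (1 / (1 - 1 / q)), by positivity, fun x r hr A hA hAm hAv => ?_⟩
  have h1 := h.measureReal_le hr hA hAm (by positivity) hAv
  rw [← Real.rpow_mul (by positivity), one_div_mul_cancel ht.ne', Real.rpow_one] at h1
  have h2 : C * (1 / (2 * C)) = 1 / 2 := by field_simp
  rw [h2] at h1
  have h3 := measureReal_sdiff hA hAm (μ := v)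
    (h.finite_left x r)
  linarith

/-- For `l` close to `1` the annulus between the radii `l r` and `r` has small relative volume, so
the inner ball keeps half of the `v`-mass. Iterating gives doubling. -/
lemma exists_growth (h : IsReverseHolderPair v w q C) :
    ∃ m : ℝ, 0 < m ∧ ∀ (x : EuclideanSpace ℝ (Fin d)) (r R : ℝ), 0 < r → r ≤ R →
      v.real (ball x R) ≤ 2 * (R / r) ^ m * v.real (ball x r) := by
  obtain ⟨η, hη, hs⟩ := h.exists_small
  have hcont : Filter.Tendsto (fun l : ℝ => 1 - l ^ d) (nhdsWithin 1 (Set.Iio 1)) (nhds 0) := by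
    have : ContinuousAt (fun l : ℝ => 1 - l ^ d) 1 := by fun_prop
    simpa using this.tendsto.mono_left nhdsWithin_le_nhds
  have hev : ∀ᶠ l : ℝ in nhdsWithin 1 (Set.Iio 1), 0 < l ∧ l < 1 ∧ 1 - l ^ d < η := by
    filter_upwards [nhdsWithin_le_nhds (lt_mem_nhds zero_lt_one), self_mem_nhdsWithin,
      hcont.eventually (gt_mem_nhds hη)] with l h1 h2 h3 using ⟨h1, h2, h3⟩
  obtain ⟨l, hl0, hl1, hl⟩ := hev.exists
  obtain ⟨m, hm, hgr⟩ := exists_growth_exponent one_lt_two hl0 hl1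
  refine ⟨m, hm, fun x r R hr hrR => hgr (fun r => v.real (ball x r)) (fun _ => measureReal_nonneg)
    (h.monotone_left x) (fun r hr => ?_) r R hr hrR⟩
  have hsub : ball x (l * r) ⊆ ball x r := ball_subset_ball (by nlinarith)
  have := hs x r hr (ball x r \ ball x (l * r)) Set.sdiff_subset
    (measurableSet_ball.diff measurableSet_ball) (by
      rw [measureReal_sdiff hsub measurableSet_ball, volumeReal_ball x hr,
        volumeReal_ball x (mul_pos hl0 hr)]
      have h0 : 0 ≤ r ^ d * volume.real (ball (0 : EuclideanSpace ℝ (Fin d)) 1) := by positivity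
      rw [mul_pow]
      nlinarith)
  rwa [Set.sdiff_sdiff_cancel_left hsub] at this

/-- A tiny concentric ball cannot carry most of the `v`-mass. Passing to `w` through both Hölder
inequalities, its complement keeps the fraction `(2C) ^ (-q)` of the `w`-mass, so each shrinking by
`ε` loses a fixed proportion. -/
lemma exists_decay (h : IsReverseHolderPair v w q C) (hd : d ≠ 0) :
    ∃ δ K : ℝ, 0 < δ ∧ 0 < K ∧ ∀ (x : EuclideanSpace ℝ (Fin d)) (r R : ℝ), 0 < r → r ≤ R →
      w.real (ball x r) ≤ K * (r / R) ^ δ * w.real (ball x R) := by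
  obtain ⟨η, hη, hs⟩ := h.exists_small
  have hcont : Filter.Tendsto (fun l : ℝ => l ^ d) (nhdsWithin 0 (Set.Ioi 0)) (nhds 0) := by
    have : ContinuousAt (fun l : ℝ => l ^ d) 0 := by fun_prop
    simpa [hd] using this.tendsto.mono_left nhdsWithin_le_nhds
  have hev : ∀ᶠ l : ℝ in nhdsWithin 0 (Set.Ioi 0), 0 < l ∧ l < 1 ∧ l ^ d < η := by
    filter_upwards [self_mem_nhdsWithin, nhdsWithin_le_nhds (gt_mem_nhds zero_lt_one),
      hcont.eventually (gt_mem_nhds hη)] with l h1 h2 h3 using ⟨h1, h2, h3⟩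
  obtain ⟨ε, he0, he1, he⟩ := hev.exists
  have hC := h.one_le
  have hq1 := h.one_lt
  have hq0 : 0 < q := zero_lt_one.trans h.one_lt
  have hq := h.one_div_lt_one
  have hCq : 1 < (2 * C) ^ q := Real.one_lt_rpow (by linarith) hq0
  have ha0 : 0 < 1 - ((2 * C) ^ q)⁻¹ := sub_pos.2 (inv_lt_one_of_one_lt₀ hCq)
  have ha1 : 1 - ((2 * C) ^ q)⁻¹ < 1 := by
    have : 0 < ((2 * C) ^ q)⁻¹ := by positivity
    linarith
  obtain ⟨δ, hδ, hdec⟩ := exists_decay_exponent ha0 ha1 he0 he1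
  refine ⟨δ, _, hδ, inv_pos.2 ha0, fun x r R hr hrR => hdec (fun r => w.real (ball x r))
    (fun _ => measureReal_nonneg) (h.monotone_right x) (fun r hr => ?_) r R hr hrR⟩
  have hsub : ball x (ε * r) ⊆ ball x r := ball_subset_ball (by nlinarith)
  have hB := volumeReal_ball_pos x hr
  have h1 := hs x r hr (ball x (ε * r)) hsub measurableSet_ball (by
    rw [volumeReal_ball x hr, volumeReal_ball x (mul_pos he0 hr)]
    have h0 : 0 ≤ r ^ d * volume.real (ball (0 : EuclideanSpace ℝ (Fin d)) 1) := by positivity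
    rw [mul_pow]
    nlinarith)
  have ht : 0 ≤ 1 - 1 / q := by linarith
  have h2 : w.real (ball x r) ^ (1 / q) ≤
      (2 * C) * w.real (ball x r \ ball x (ε * r)) ^ (1 / q) := by
    calc w.real (ball x r) ^ (1 / q)
        ≤ C * volume.real (ball x r) ^ (1 / q - 1) * v.real (ball x r) := h.reverse x r hr
      _ ≤ C * volume.real (ball x r) ^ (1 / q - 1) *
          (2 * (w.real (ball x r \ ball x (ε * r)) ^ (1 / q) *
            volume.real (ball x r) ^ (1 - 1 / q))) := by
        gcongr
        refine h1.trans ?_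
        gcongr
        refine (h.holder _ x r Set.sdiff_subset
          (measurableSet_ball.diff measurableSet_ball)).trans ?_
        gcongr
        · exact measure_ball_lt_top.ne
        · exact Set.sdiff_subset
      _ = (2 * C) * w.real (ball x r \ ball x (ε * r)) ^ (1 / q) *
          (volume.real (ball x r) ^ (1 / q - 1) * volume.real (ball x r) ^ (1 - 1 / q)) := by
        ring
      _ = _ := by rw [← Real.rpow_add hB]; simp
  have h3 : w.real (ball x r) ≤ (2 * C) ^ q * w.real (ball x r \ ball x (ε * r)) := by
    have := Real.rpow_le_rpow (by positivity) h2 hq0.le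
    rwa [Real.mul_rpow (by positivity) (by positivity), ← Real.rpow_mul measureReal_nonneg,
      ← Real.rpow_mul measureReal_nonneg, one_div_mul_cancel hq0.ne', Real.rpow_one,
      Real.rpow_one] at this
  have h4 := measureReal_sdiff hsub measurableSet_ball (μ := w) (h.finite_right x _)
  have h5 : ((2 * C) ^ q)⁻¹ * w.real (ball x r) ≤ w.real (ball x r \ ball x (ε * r)) := by
    rw [inv_mul_le_iff₀ (by positivity)]; exact h3
  linarith

/-- Power decay of `r ^ (2 - d) v(B(x, r))` when `q = d / 2`. -/
lemma exists_scaled_decay (h : IsReverseHolderPair v w ((d : ℝ) / 2) C) (hd : 3 ≤ d) :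
    ∃ δ K : ℝ, 0 < δ ∧ 0 < K ∧ ∀ (x : EuclideanSpace ℝ (Fin d)) (r R : ℝ), 0 < r → r ≤ R →
      1 / r ^ (d - 2) * v.real (ball x r) ≤
        K * (r / R) ^ δ * (1 / R ^ (d - 2) * v.real (ball x R)) := by
  obtain ⟨δ, K, hδ, hK, hw⟩ := h.exists_decay (by omega)
  have hC := h.one_le
  have hd0 : (0 : ℝ) < d := by positivity
  set κ := volume.real (ball (0 : EuclideanSpace ℝ (Fin d)) 1) with hκ
  have hκ0 : 0 < κ := volumeReal_ball_pos _ one_pos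
  have hq : 1 / ((d : ℝ) / 2) = 2 / d := by rw [one_div_div]
  -- With `q = d / 2` the Hölder factor `|B(x, r)| ^ (1 - 1/q)` is a multiple of `r ^ (d - 2)` and
  -- cancels the normalisation exactly; only the decay of `w ^ (2 / d)` remains.
  have hcast : ((d - 2 : ℕ) : ℝ) = d * (1 - 2 / d) := by
    rw [Nat.cast_sub (by omega)]; field_simp; norm_num
  have hpow : ∀ r : ℝ, 0 < r → (r ^ d) ^ (1 - 2 / (d : ℝ)) = r ^ (d - 2) := by
    intro r hr
    rw [← Real.rpow_natCast, ← Real.rpow_mul hr.le, ← hcast, Real.rpow_natCast]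
  refine ⟨δ * (2 / d), K ^ (2 / (d : ℝ)) * C, by positivity, by positivity,
    fun x r R hr hrR => ?_⟩
  have hR : 0 < R := hr.trans_le hrR
  have h1 := h.holder (ball x r) x r subset_rfl measurableSet_ball
  have h2 := h.reverse x R hR
  rw [hq, volumeReal_ball x hr, Real.mul_rpow (by positivity) hκ0.le, hpow r hr] at h1
  rw [hq, volumeReal_ball x hR, Real.mul_rpow (by positivity) hκ0.le,
    show 2 / (d : ℝ) - 1 = -(1 - 2 / d) by ring, Real.rpow_neg (by positivity), hpow R hR,
    Real.rpow_neg hκ0.le] at h2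
  have h3 : w.real (ball x r) ^ (2 / (d : ℝ)) ≤
      K ^ (2 / (d : ℝ)) * (r / R) ^ (δ * (2 / d)) * w.real (ball x R) ^ (2 / (d : ℝ)) := by
    have := Real.rpow_le_rpow measureReal_nonneg (hw x r R hr hrR)
      (show 0 ≤ 2 / (d : ℝ) by positivity)
    rwa [Real.mul_rpow (by positivity) measureReal_nonneg,
      Real.mul_rpow hK.le (by positivity), ← Real.rpow_mul (by positivity)] at this
  have hκp : 0 < κ ^ (1 - 2 / (d : ℝ)) := by positivity
  calc 1 / r ^ (d - 2) * v.real (ball x r)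
      ≤ 1 / r ^ (d - 2) * ((K ^ (2 / (d : ℝ)) * (r / R) ^ (δ * (2 / d)) *
          (C * ((R ^ (d - 2))⁻¹ * (κ ^ (1 - 2 / (d : ℝ)))⁻¹) * v.real (ball x R))) *
          (r ^ (d - 2) * κ ^ (1 - 2 / (d : ℝ)))) := by
        gcongr
        refine h1.trans ?_
        gcongr
        refine h3.trans ?_
        gcongr
    _ = _ := by
        field_simp

/-- By doubling, zero mass on one ball forces zero mass on all larger concentric balls, hence `v =
0`. -/
lemma pos (h : IsReverseHolderPair v w q C) (hv : v ≠ 0) (x : EuclideanSpace ℝ (Fin d)) {r : ℝ}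
    (hr : 0 < r) : 0 < v.real (ball x r) := by
  obtain ⟨m, -, hm⟩ := h.exists_growth
  by_contra hcon
  have h0 : v.real (ball x r) = 0 := le_antisymm (not_lt.1 hcon) measureReal_nonneg
  apply hv
  rw [← Measure.measure_univ_eq_zero, ← iUnion_ball_nat x, measure_iUnion_null_iff]
  intro n
  have h1 : v.real (ball x (max n r)) = 0 := by
    refine le_antisymm ?_ measureReal_nonneg
    simpa [h0] using hm x r (max n r) hr (le_max_right _ _)
  have h2 : v (ball x (max n r)) = 0 := by
    rwa [measureReal_eq_zero_iff (h.finite_left x _)] at h1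
  exact measure_mono_null (ball_subset_ball (le_max_left _ _)) h2

end IsReverseHolderPair

/-! ### From the potential to a reverse Hölder pair -/

lemma ballAverage_eq_lintegral {d : ℕ} (x : EuclideanSpace ℝ (Fin d)) (r : ℝ)
    (g : EuclideanSpace ℝ (Fin d) → ℝ≥0∞) :
    ballAverage x r g = ∫⁻ y, g y ∂((volume (ball x r))⁻¹ • volume.restrict (ball x r)) := by
  rw [lintegral_smul_measure, ballAverage, smul_eq_mul]

lemma isProbabilityMeasure_ball {d : ℕ} (x : EuclideanSpace ℝ (Fin d)) {r : ℝ} (hr : 0 < r) :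
    IsProbabilityMeasure ((volume (ball x r))⁻¹ • volume.restrict (ball x r)) :=
  ⟨by simp [ENNReal.inv_mul_cancel (measure_ball_pos volume x hr).ne' measure_ball_lt_top.ne]⟩

lemma lintegral_ofReal_ball_lt_top {d : ℕ} {f : EuclideanSpace ℝ (Fin d) → ℝ}
    (hf : LocallyIntegrable f volume) (x : EuclideanSpace ℝ (Fin d)) (r : ℝ) :
    ∫⁻ y in ball x r, ENNReal.ofReal (f y) < ∞ := by
  have h := (hf.integrableOn_isCompact (isCompact_closedBall x r)).mono_set ball_subset_closedBall
  exact (lintegral_mono fun y => Real.ofReal_le_enorm (f y)).trans_lt h.2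

namespace IsPotential

variable {d : ℕ} {V : EuclideanSpace ℝ (Fin d) → ℝ}

/-- `L^p` means over a probability measure increase with the exponent, so the inequality for `s ≥
d/2` implies the one for `d/2`. -/
lemma exists_average_rpow_le (hV : IsPotential V) (hd : 3 ≤ d) :
    ∃ C : ℝ, 1 ≤ C ∧ ∀ (x : EuclideanSpace ℝ (Fin d)) (r : ℝ), 0 < r →
      (ballAverage x r fun y => ENNReal.ofReal (V y) ^ ((d : ℝ) / 2)) ^ (1 / ((d : ℝ) / 2)) ≤
        ENNReal.ofReal C * ballAverage x r fun y => ENNReal.ofReal (V y) := by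
  obtain ⟨s, hs, C, hC, hrev⟩ := hV.reverseHolder
  have hd0 : (0 : ℝ) < (d : ℝ) / 2 := by positivity
  refine ⟨max 1 C, le_max_left _ _, fun x r hr => ?_⟩
  have := isProbabilityMeasure_ball x hr
  have hmeas : AEStronglyMeasurable (fun y => ENNReal.ofReal (V y))
      ((volume (ball x r))⁻¹ • volume.restrict (ball x r)) :=
    ((hV.locallyIntegrable.aestronglyMeasurable.aemeasurable.ennreal_ofReal.restrict).smul_measure
      _).aestronglyMeasurable
  have hC' : ENNReal.ofReal C * (ballAverage x r fun y => ENNReal.ofReal (V y)) ≤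
      ENNReal.ofReal (max 1 C) * ballAverage x r fun y => ENNReal.ofReal (V y) := by
    gcongr
    exact le_max_right _ _
  refine le_trans ?_ ((hrev x r hr).trans hC')
  split_ifs with hsi
  · have h1 := eLpNorm'_le_eLpNormEssSup (f := fun y => ENNReal.ofReal (V y))
      (μ := (volume (ball x r))⁻¹ • volume.restrict (ball x r)) hd0
    refine le_trans ?_ (essSup_mono_measure (f := fun y => ENNReal.ofReal (V y))
      (Measure.smul_absolutelyContinuous (c := (volume (ball x r))⁻¹)))
    simpa [eLpNorm', eLpNormEssSup, ballAverage_eq_lintegral] using h1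
  · have hds : (d : ℝ) / 2 ≤ s.toReal := by
      have := ENNReal.toReal_mono hsi hs
      simpa using this
    have h1 := eLpNorm'_le_eLpNorm'_of_exponent_le hd0 hds _ hmeas
    simpa [eLpNorm', ballAverage_eq_lintegral] using h1

lemma exists_isReverseHolderPair (hV : IsPotential V) (hd : 3 ≤ d) :
    ∃ (v w : Measure (EuclideanSpace ℝ (Fin d))) (C : ℝ),
      IsReverseHolderPair v w ((d : ℝ) / 2) C ∧ v ≠ 0 ∧
        ∀ x r, v.real (ball x r) = ∫ y in ball x r, V y := by
  obtain ⟨C, hC, hrev⟩ := hV.exists_average_rpow_le hd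
  have hd0 : (0 : ℝ) < (d : ℝ) / 2 := by positivity
  have hq : 1 < (d : ℝ) / 2 := by
    have : (3 : ℝ) ≤ d := by exact_mod_cast hd
    linarith
  have hq1 : 1 / ((d : ℝ) / 2) < 1 := by rw [div_lt_one hd0]; exact hq
  have hmeas : AEMeasurable (fun y => ENNReal.ofReal (V y)) volume :=
    hV.locallyIntegrable.aestronglyMeasurable.aemeasurable.ennreal_ofReal
  set v := (volume : Measure (EuclideanSpace ℝ (Fin d))).withDensity
    fun y => ENNReal.ofReal (V y) with hv
  set w := (volume : Measure (EuclideanSpace ℝ (Fin d))).withDensity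
    fun y => ENNReal.ofReal (V y) ^ ((d : ℝ) / 2) with hw
  have hvtop : ∀ x r, v (ball x r) ≠ ∞ := fun x r => by
    rw [hv, withDensity_apply _ measurableSet_ball]
    exact (lintegral_ofReal_ball_lt_top hV.locallyIntegrable x r).ne
  have hrev' : ∀ x r, 0 < r → ((volume (ball x r))⁻¹ * w (ball x r)) ^ (1 / ((d : ℝ) / 2)) ≤
      ENNReal.ofReal C * ((volume (ball x r))⁻¹ * v (ball x r)) := by
    intro x r hr
    rw [hw, hv, withDensity_apply _ measurableSet_ball, withDensity_apply _ measurableSet_ball]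
    exact hrev x r hr
  -- Local integrability of `V ^ (d/2)` is not assumed: it follows from the reverse Hölder
  -- inequality, whose right side is finite.
  have hwtop : ∀ x r, w (ball x r) ≠ ∞ := by
    intro x r
    rcases le_or_gt r 0 with hr | hr
    · simp [ball_eq_empty.2 hr]
    intro htop
    have h1 := hrev' x r hr
    rw [htop, ENNReal.mul_top (ENNReal.inv_ne_zero.2 measure_ball_lt_top.ne),
      ENNReal.top_rpow_of_pos (by positivity), top_le_iff] at h1
    exact ENNReal.mul_ne_top ENNReal.ofReal_ne_top (ENNReal.mul_ne_top
      (ENNReal.inv_ne_top.2 (measure_ball_pos _ _ hr).ne') (hvtop x r)) h1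
  refine ⟨v, w, C, ⟨hq, hC, hvtop, hwtop, fun A x r hA hAm => ?_, fun x r hr => ?_⟩, ?_, ?_⟩
  · have hconj := Real.HolderConjugate.conjExponent hq
    have h1 := ENNReal.lintegral_mul_le_Lp_mul_Lq (volume.restrict A) hconj
      hmeas.restrict (g := fun _ => 1) aemeasurable_const
    have h2 : v A ≤ w A ^ (1 / ((d : ℝ) / 2)) * volume A ^ (1 - 1 / ((d : ℝ) / 2)) := by
      rw [hw, hv, withDensity_apply _ hAm, withDensity_apply _ hAm]
      have h3 : 1 / ((d : ℝ) / 2).conjExponent = 1 - 1 / ((d : ℝ) / 2) := by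
        have := hconj.inv_add_inv_eq_one
        simp only [one_div]
        linarith
      rw [h3] at h1
      simpa using h1
    have hvA : volume A ≠ ∞ := measure_ne_top_of_subset hA measure_ball_lt_top.ne
    have hwA : w A ≠ ∞ := measure_ne_top_of_subset hA (hwtop x r)
    have h4 := ENNReal.toReal_mono (ENNReal.mul_ne_top
      (ENNReal.rpow_ne_top_of_nonneg (by positivity) hwA)
      (ENNReal.rpow_ne_top_of_nonneg (by linarith) hvA)) h2
    rwa [ENNReal.toReal_mul, ← ENNReal.toReal_rpow, ← ENNReal.toReal_rpow] at h4
  · have hB := volumeReal_ball_pos x hr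
    have h1 := ENNReal.toReal_mono (ENNReal.mul_ne_top ENNReal.ofReal_ne_top (ENNReal.mul_ne_top
      (ENNReal.inv_ne_top.2 (measure_ball_pos volume x hr).ne') (hvtop x r))) (hrev' x r hr)
    rw [← ENNReal.toReal_rpow, ENNReal.toReal_mul, ENNReal.toReal_mul, ENNReal.toReal_mul,
      ENNReal.toReal_inv, ENNReal.toReal_ofReal (by linarith)] at h1
    change ((volume.real (ball x r))⁻¹ * w.real (ball x r)) ^ (1 / ((d : ℝ) / 2)) ≤
      C * ((volume.real (ball x r))⁻¹ * v.real (ball x r)) at h1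
    rw [Real.mul_rpow (by positivity) measureReal_nonneg, Real.inv_rpow hB.le,
      inv_mul_le_iff₀ (by positivity)] at h1
    refine h1.trans_eq ?_
    rw [Real.rpow_sub hB, Real.rpow_one]
    ring
  · rw [hv, Ne, withDensity_eq_zero_iff hmeas]
    intro h0
    refine hV.ne_zero ?_
    filter_upwards [h0] with y hy
    exact le_antisymm (ENNReal.ofReal_eq_zero.1 hy) (hV.nonneg y)
  · intro x r
    rw [measureReal_def, hv, withDensity_apply _ measurableSet_ball,
      integral_eq_lintegral_of_nonneg_ae (Filter.Eventually.of_forall hV.nonneg)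
        hV.locallyIntegrable.aestronglyMeasurable.restrict]

end IsPotential

/-! ### The critical radius and its comparison inequality -/

section CriticalRadius

variable {d : ℕ} {V : EuclideanSpace ℝ (Fin d) → ℝ}

lemma Real.exists_rpow_eq {δ a : ℝ} (hδ : 0 < δ) (ha : 0 < a) : ∃ t : ℝ, 0 < t ∧ t ^ δ = a :=
  ⟨a ^ (1 / δ), by positivity, by
    rw [← Real.rpow_mul ha.le, one_div_mul_cancel hδ.ne', Real.rpow_one]⟩

/-- The scaled mass `r ^ (2 - d) ∫_{B(x, r)} V` grows at a power rate in `r`, and enlarging or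
moving the ball changes it by at most a power of the ratio of the radii. -/
lemma IsPotential.exists_scaledMass_bounds (hV : IsPotential V) (hd : 3 ≤ d) :
    ∃ δ K m : ℝ, 0 < δ ∧ 1 ≤ K ∧ 0 < m ∧
      (∀ x r, 0 < r → 0 < 1 / r ^ (d - 2) * ∫ y in ball x r, V y) ∧
      (∀ x r R, 0 < r → r ≤ R → 1 / r ^ (d - 2) * ∫ y in ball x r, V y ≤
        K * (r / R) ^ δ * (1 / R ^ (d - 2) * ∫ y in ball x R, V y)) ∧
      (∀ x y r R, 0 < r → r ≤ R → dist x y ≤ R → 1 / R ^ (d - 2) * ∫ z in ball y R, V z ≤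
        K * (R / r) ^ m * (1 / r ^ (d - 2) * ∫ z in ball x r, V z)) := by
  obtain ⟨v, w, C, h, hv0, hv⟩ := hV.exists_isReverseHolderPair hd
  obtain ⟨δ, K, hδ, hK, hdec⟩ := h.exists_scaled_decay hd
  obtain ⟨m, hm, hgr⟩ := h.exists_growth
  simp only [← hv]
  -- The constant `2 * 2 ^ m` is the doubling cost from `B(x, r)` to `B(x, 2R)`, which contains
  -- `B(y, R)`.
  refine ⟨δ, max (max 1 K) (2 * 2 ^ m), m, hδ, (le_max_left 1 K).trans (le_max_left _ _), hm,
    fun x r hr => ?_, fun x r R hr hrR => ?_, fun x y r R hr hrR hxy => ?_⟩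
  · have := h.pos hv0 x hr
    positivity
  · have hR : 0 < R := hr.trans_le hrR
    refine (hdec x r R hr hrR).trans ?_
    gcongr
    exact (le_max_right 1 K).trans (le_max_left _ _)
  · have hR : 0 < R := hr.trans_le hrR
    have h1 : v.real (ball y R) ≤ v.real (ball x (2 * R)) :=
      measureReal_mono (ball_subset_ball' (by rw [dist_comm]; linarith)) (h.finite_left x _)
    calc 1 / R ^ (d - 2) * v.real (ball y R)
        ≤ 1 / r ^ (d - 2) * (2 * (2 * R / r) ^ m * v.real (ball x r)) := by
          gcongr
          exact h1.trans (hgr x r (2 * R) hr (by linarith))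
      _ = (2 * 2 ^ m) * (R / r) ^ m * (1 / r ^ (d - 2) * v.real (ball x r)) := by
          rw [mul_div_assoc, Real.mul_rpow (by positivity) (by positivity)]; ring
      _ ≤ _ := by
          gcongr
          exact le_max_right _ _

/-- `sSup` in `ℝ` defaults to `0` on empty or unbounded sets, so both cases must be excluded.
Comparing with radius `1`, the power law makes the scaled mass exceed `1` for large `r` and drop
below `1` for small `r`. -/
lemma IsPotential.criticalRadius_spec (hV : IsPotential V) (hd : 3 ≤ d)
    {x : EuclideanSpace ℝ (Fin d)} :
    BddAbove {r : ℝ | 0 < r ∧ 1 / r ^ (d - 2) * ∫ y in ball x r, V y ≤ 1} ∧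
      0 < criticalRadius V x := by
  obtain ⟨δ, K, m, hδ, hK, hm, hpos, hdec, -⟩ := hV.exists_scaledMass_bounds hd
  have h1 := hpos x 1 one_pos
  have hbdd : BddAbove {r : ℝ | 0 < r ∧ 1 / r ^ (d - 2) * ∫ y in ball x r, V y ≤ 1} := by
    obtain ⟨t, ht, hte⟩ := Real.exists_rpow_eq hδ
      (show 0 < K / (1 / 1 ^ (d - 2) * ∫ y in ball x 1, V y) by positivity)
    refine ⟨max 1 t, fun r ⟨hr, hle⟩ => ?_⟩
    by_contra! hcon
    obtain ⟨hr1, hrt⟩ := max_lt_iff.1 hcon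
    have h2 := hdec x 1 r one_pos hr1.le
    have h3 : K * (1 / r) ^ δ * (1 / r ^ (d - 2) * ∫ y in ball x r, V y) ≤ K * (1 / r) ^ δ * 1 := by
      gcongr
    have h4 : t ^ δ < r ^ δ := Real.rpow_lt_rpow ht.le hrt hδ
    rw [hte, div_lt_iff₀ h1] at h4
    have h5 := h2.trans h3
    rw [one_div r, Real.inv_rpow hr.le, mul_one, ← div_eq_mul_inv, le_div_iff₀ (by positivity)] at h5
    nlinarith
  refine ⟨hbdd, ?_⟩
  obtain ⟨t, ht, hte⟩ := Real.exists_rpow_eq hδ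
    (show 0 < 1 / (K * (1 / 1 ^ (d - 2) * ∫ y in ball x 1, V y)) by positivity)
  have hmin : 0 < min 1 t := lt_min one_pos ht
  refine hmin.trans_le (le_csSup hbdd ⟨hmin, ?_⟩)
  refine (hdec x (min 1 t) 1 hmin (min_le_left _ _)).trans ?_
  have h2 : (min 1 t / 1) ^ δ ≤ t ^ δ := by
    rw [div_one]
    exact Real.rpow_le_rpow hmin.le (min_le_right _ _) hδ.le
  calc K * (min 1 t / 1) ^ δ * (1 / 1 ^ (d - 2) * ∫ y in ball x 1, V y)
      ≤ K * t ^ δ * (1 / 1 ^ (d - 2) * ∫ y in ball x 1, V y) := by gcongr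
    _ = 1 := by
      have := h1.ne'
      rw [hte]
      generalize (1 / 1 ^ (d - 2) * ∫ y in ball x 1, V y) = I at *
      field_simp

lemma IsPotential.criticalRadius_pos (hV : IsPotential V) (hd : 3 ≤ d)
    (x : EuclideanSpace ℝ (Fin d)) : 0 < criticalRadius V x :=
  (hV.criticalRadius_spec hd).2

/-- It suffices to exhibit a radius admissible at `y`. Starting from radius `ρ(x)/2`, enlarge and
move to a ball at `y` of radius `ρ(x) + |x - y|`, losing a power `m` of the ratio, then shrink until
the decay with exponent `δ` recovers the loss; hence `N = m / δ`. -/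
lemma IsPotential.exists_criticalRadius_ge (hV : IsPotential V) (hd : 3 ≤ d) :
    ∃ c N : ℝ, 0 < c ∧ c ≤ 1 ∧ 0 < N ∧ ∀ x y : EuclideanSpace ℝ (Fin d),
      c * (1 + dist x y / criticalRadius V x) ^ (-N) ≤ criticalRadius V y / criticalRadius V x := by
  obtain ⟨δ, K, m, hδ, hK, hm, hpos, hdec, hmove⟩ := hV.exists_scaledMass_bounds hd
  obtain ⟨c, hc, hce⟩ := Real.exists_rpow_eq hδ
    (show 0 < 1 / (K * K * 2 ^ m * K) by positivity)
  have hK3 : 1 ≤ K * K * 2 ^ m * K := by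
    have : (1 : ℝ) ≤ 2 ^ m := Real.one_le_rpow one_le_two hm.le
    have h2 : 1 ≤ K * K := by nlinarith
    have h3 : 1 ≤ K * K * 2 ^ m := by nlinarith
    nlinarith
  have hc1 : c ≤ 1 := by
    by_contra! h
    have := Real.one_lt_rpow h hδ
    rw [hce, lt_div_iff₀ (by positivity)] at this
    linarith
  refine ⟨c, m / δ, hc, hc1, by positivity, fun x y => ?_⟩
  have hρ := hV.criticalRadius_pos hd x
  set ρ := criticalRadius V x with hρdef
  obtain ⟨hby, -⟩ := hV.criticalRadius_spec hd (x := y)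
  have hne : {r : ℝ | 0 < r ∧ 1 / r ^ (d - 2) * ∫ y in ball x r, V y ≤ 1}.Nonempty := by
    by_contra hcon
    rw [hρdef, criticalRadius, Set.not_nonempty_iff_eq_empty.1 hcon, Real.sSup_empty] at hρ
    exact lt_irrefl _ hρ
  set u := 1 + dist x y / ρ with hu
  have hu1 : 1 ≤ u := le_add_of_nonneg_right (by positivity)
  have hu0 : 0 < u := by linarith
  -- The supremum need not be attained, so an admissible radius above `ρ / 2` is used.
  have hhalf : 1 / (ρ / 2) ^ (d - 2) * ∫ z in ball x (ρ / 2), V z ≤ K := by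
    obtain ⟨r, ⟨hr, hle⟩, hlt⟩ := exists_lt_of_lt_csSup
      hne (half_lt_self hρ)
    refine (hdec x (ρ / 2) r (by positivity) hlt.le).trans ?_
    have h1 : (ρ / 2 / r) ^ δ ≤ 1 :=
      Real.rpow_le_one (by positivity) ((div_le_one hr).2 hlt.le) hδ.le
    have h2 := hpos x r hr
    calc K * (ρ / 2 / r) ^ δ * (1 / r ^ (d - 2) * ∫ z in ball x r, V z) ≤ K * 1 * 1 := by gcongr
      _ = K := by ring
  have hRu : ρ * u = ρ + dist x y := by rw [hu]; field_simp
  have hR : 0 < ρ * u := by positivity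
  -- The shrinking factor is fixed by `K * t ^ δ * (K * (2 * u) ^ m * K) = 1`.
  set t := c * u ^ (-(m / δ)) with ht
  have hupow : u ^ (-(m / δ)) ≤ 1 := Real.rpow_le_one_of_one_le_of_nonpos hu1
    (by have : 0 < m / δ := by positivity
        linarith)
  have ht0 : 0 < t := by positivity
  have ht1 : t ≤ 1 := mul_le_one₀ hc1 (by positivity) hupow
  have hmem : 1 / (t * (ρ * u)) ^ (d - 2) * ∫ z in ball y (t * (ρ * u)), V z ≤ 1 := by
    refine (hdec y (t * (ρ * u)) (ρ * u) (by positivity) (by nlinarith)).trans ?_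
    have h1 := hmove x y (ρ / 2) (ρ * u) (by positivity) (by nlinarith)
      (by rw [hRu]; linarith)
    have h2 : ρ * u / (ρ / 2) = 2 * u := by field_simp
    have h3 : t * (ρ * u) / (ρ * u) = t := by field_simp
    rw [h2] at h1
    rw [h3]
    have h4 : t ^ δ = 1 / (K * K * 2 ^ m * K) * (u ^ m)⁻¹ := by
      rw [ht, Real.mul_rpow hc.le (by positivity), hce, ← Real.rpow_mul hu0.le, neg_mul,
        div_mul_cancel₀ _ hδ.ne', Real.rpow_neg hu0.le]
    have hum : 0 < u ^ m := by positivity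
    calc K * t ^ δ * (1 / (ρ * u) ^ (d - 2) * ∫ z in ball y (ρ * u), V z)
        ≤ K * t ^ δ * (K * (2 * u) ^ m * K) := by
          refine mul_le_mul_of_nonneg_left (h1.trans ?_) (by positivity)
          gcongr
      _ = 1 := by
          rw [h4, Real.mul_rpow two_pos.le hu0.le]
          field_simp
  have hge : t * (ρ * u) ≤ criticalRadius V y := le_csSup hby ⟨by positivity, hmem⟩
  rw [le_div_iff₀ hρ]
  refine le_trans ?_ hge
  have : 0 < t * ρ := by positivity
  nlinarith

/-- With `a = ρ(y)/ρ(x)` and `u = |x - y|/ρ(x)`, the lower bound with `x` and `y` exchanged reads `c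
a ≤ (1 + u/a) ^ N`. Solving it for `a` produces the exponent `N/(N+1)`. -/
lemma IsPotential.exists_isComparisonPair (hV : IsPotential V) (hd : 3 ≤ d) :
    ∃ C₀ N₀ : ℝ, IsComparisonPair (criticalRadius V) C₀ N₀ := by
  obtain ⟨c, N, hc, hc1, hN, h⟩ := hV.exists_criticalRadius_ge hd
  have h2N : (1 : ℝ) ≤ 2 ^ N := Real.one_le_rpow one_le_two hN.le
  have hC1 : 1 ≤ 2 ^ N / c := by rw [le_div_iff₀ hc]; linarith
  refine ⟨2 ^ N / c, N, hC1, hN, fun x y => ⟨?_, ?_⟩⟩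
  · refine le_trans ?_ (h x y)
    gcongr
    · have := hV.criticalRadius_pos hd x
      positivity
    · rw [one_div_div, div_le_iff₀ (by positivity)]
      nlinarith
  · have hx := hV.criticalRadius_pos hd x
    have hy := hV.criticalRadius_pos hd y
    set a := criticalRadius V y / criticalRadius V x with ha
    set u := dist x y / criticalRadius V x with hu
    have ha0 : 0 < a := by positivity
    have hu0 : 0 ≤ u := by positivity
    have h1 := h y x
    have hua : dist y x / criticalRadius V y = u / a := by
      rw [hu, ha, dist_comm]; field_simp
    have hinv : criticalRadius V x / criticalRadius V y = a⁻¹ := by rw [ha, inv_div]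
    clear_value a u
    rw [hua, hinv, Real.rpow_neg (by positivity)] at h1
    have h2 : c * a ≤ (1 + u / a) ^ N := by
      have hp : 0 < (1 + u / a) ^ N := by positivity
      rw [← div_eq_mul_inv, div_le_iff₀ hp, ← div_eq_inv_mul, le_div_iff₀ ha0] at h1
      exact h1
    have hone : 1 ≤ (1 + u) ^ (N / (N + 1)) := Real.one_le_rpow (by linarith) (by positivity)
    -- If `u ≤ a` the right side is at most `2 ^ N`; otherwise it is at most `(2u/a) ^ N`, and
    -- multiplying by `a ^ N` bounds `a ^ (N + 1)`.
    rcases le_total u a with hle | hle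
    · have h3 : (1 + u / a) ^ N ≤ 2 ^ N := by
        gcongr
        have := (div_le_one ha0).2 hle
        linarith
      have h4 : a ≤ 2 ^ N / c := by
        rw [le_div_iff₀ hc]; linarith
      nlinarith
    · have h3 : (1 + u / a) ^ N ≤ 2 ^ N * (u / a) ^ N := by
        rw [← Real.mul_rpow (by positivity) (by positivity)]
        gcongr
        have := (one_le_div ha0).2 hle
        linarith
      have h4 : a ^ (N + 1) ≤ 2 ^ N / c * (1 + u) ^ N := by
        have h5 : (u / a) ^ N = u ^ N / a ^ N := Real.div_rpow hu0 ha0.le _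
        have haN : 0 < a ^ N := by positivity
        have h6 : u ^ N ≤ (1 + u) ^ N := by gcongr; linarith
        rw [h5] at h3
        have h7 := h2.trans h3
        rw [← mul_div_assoc, le_div_iff₀ haN] at h7
        rw [Real.rpow_add ha0, Real.rpow_one, div_mul_eq_mul_div, le_div_iff₀ hc]
        nlinarith
      have h8 := Real.rpow_le_rpow (by positivity) h4 (show 0 ≤ 1 / (N + 1) by positivity)
      rw [← Real.rpow_mul ha0.le, mul_one_div_cancel (by positivity), Real.rpow_one,
        Real.mul_rpow (by positivity) (by positivity), ← Real.rpow_mul (by positivity),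
        mul_one_div] at h8
      refine h8.trans ?_
      gcongr
      calc (2 ^ N / c) ^ (1 / (N + 1)) ≤ (2 ^ N / c) ^ (1 : ℝ) := by
            refine Real.rpow_le_rpow_of_exponent_le hC1 ?_
            rw [div_le_one (by positivity)]; linarith
        _ = _ := Real.rpow_one _

end CriticalRadius

/-! ### Positivity of `A_p` weights and Hölder's inequality -/

section Weights

variable {d : ℕ} {ρ ω : EuclideanSpace ℝ (Fin d) → ℝ} {θ p : ℝ}

/-- The quantity controlled by the `A_p` condition on the ball `B(x₀, r)`. -/
noncomputable def apBallConst (p : ℝ) (ω : EuclideanSpace ℝ (Fin d) → ℝ)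
    (x₀ : EuclideanSpace ℝ (Fin d)) (r : ℝ) : ℝ≥0∞ :=
  if p = 1 then
    (ballAverage x₀ r fun x => ENNReal.ofReal (ω x))
      * (essInf (fun x => ENNReal.ofReal (ω x)) (volume.restrict (ball x₀ r)))⁻¹
  else
    (ballAverage x₀ r fun x => ENNReal.ofReal (ω x)) ^ (1 / p)
      * (ballAverage x₀ r fun x => ENNReal.ofReal (ω x) ^ (-(p.conjExponent / p)))
          ^ (1 / p.conjExponent)

lemma mul_apBallConst_le (ρ : EuclideanSpace ℝ (Fin d) → ℝ) (θ p : ℝ)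
    (ω : EuclideanSpace ℝ (Fin d) → ℝ) (x₀ : EuclideanSpace ℝ (Fin d)) {r : ℝ} (hr : 0 < r) :
    ENNReal.ofReal ((1 + r / ρ x₀) ^ (-θ)) * apBallConst p ω x₀ r ≤ apCharacteristic ρ θ p ω :=
  le_iSup_of_le x₀ (le_iSup_of_le r (le_iSup_of_le hr le_rfl))

lemma restrict_ball_ne_zero (x : EuclideanSpace ℝ (Fin d)) {r : ℝ} (hr : 0 < r) :
    volume.restrict (ball x r) ≠ 0 := by
  rw [Ne, Measure.restrict_eq_zero]
  exact (measure_ball_pos _ _ hr).ne'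

lemma IsWeight.aemeasurable (h : IsWeight ω) : AEMeasurable (fun x => ENNReal.ofReal (ω x)) volume :=
  h.locallyIntegrable.aestronglyMeasurable.aemeasurable.ennreal_ofReal

lemma ballAverage_ne_zero {x : EuclideanSpace ℝ (Fin d)} {r : ℝ}
    {g : EuclideanSpace ℝ (Fin d) → ℝ≥0∞} (h : ∫⁻ y in ball x r, g y ≠ 0) :
    ballAverage x r g ≠ 0 :=
  mul_ne_zero (ENNReal.inv_ne_zero.2 measure_ball_lt_top.ne) h

namespace IsApWeight

/-- Positive mass makes the first `A_p` factor nonzero, so the dual factor is finite (for `p = 1`,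
the essential infimum is nonzero). Without the mass assumption the condition is void, since `0 * ∞ =
0`. -/
lemma ae_pos_on_ball (h : IsApWeight ρ θ p ω) (hp : 1 ≤ p) {x : EuclideanSpace ℝ (Fin d)} {r : ℝ}
    (hr : 0 < r) (hne : ∫⁻ y in ball x r, ENNReal.ofReal (ω y) ≠ 0) :
    ∀ᵐ y ∂volume.restrict (ball x r), 0 < ω y := by
  obtain ⟨C, hC, hA⟩ := h.2
  have havg := ballAverage_ne_zero hne
  have hx := hA x r hr
  split_ifs at hx with hp1
  · have he : essInf (fun x => ENNReal.ofReal (ω x)) (volume.restrict (ball x r)) ≠ 0 := by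
      intro he
      rw [he, mul_zero] at hx
      exact havg (le_antisymm hx zero_le)
    filter_upwards [ae_essInf_le (f := fun x => ENNReal.ofReal (ω x))
      (μ := volume.restrict (ball x r))] with y hy
    exact ENNReal.ofReal_pos.1 ((pos_iff_ne_zero.2 he).trans_le hy)
  · have hp' : 1 < p := lt_of_le_of_ne hp (Ne.symm hp1)
    have hconj := Real.HolderConjugate.conjExponent hp'
    have hfin : ballAverage x r (fun x => ENNReal.ofReal (ω x) ^ (-(p.conjExponent / p))) ≠ ∞ := by
      intro htop
      rw [htop, ENNReal.top_rpow_of_pos (by have := hconj.symm.pos; positivity),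
        ENNReal.mul_top, top_le_iff] at hx
      · exact ENNReal.ofReal_ne_top hx
      · exact (ENNReal.rpow_pos_of_nonneg (pos_iff_ne_zero.2 havg)
          (by have := hconj.pos; positivity)).ne'
    have hfin' : ∫⁻ y in ball x r, ENNReal.ofReal (ω y) ^ (-(p.conjExponent / p)) ≠ ∞ := by
      intro htop
      rw [ballAverage, htop, ENNReal.mul_top
        (ENNReal.inv_ne_zero.2 measure_ball_lt_top.ne)] at hfin
      exact hfin rfl
    filter_upwards [ae_lt_top' (h.1.aemeasurable.restrict.pow_const _) hfin'] with y hy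
    by_contra hcon
    rw [ENNReal.ofReal_of_nonpos (not_lt.1 hcon), ENNReal.zero_rpow_of_neg] at hy
    · exact lt_irrefl _ hy
    · have h1 := hconj.pos
      have h2 := hconj.symm.pos
      have : 0 < p.conjExponent / p := by positivity
      linarith

/-- Some ball about the origin has positive mass, hence so does every larger one, and these exhaust
the space. -/
lemma ae_pos (h : IsApWeight ρ θ p ω) (hp : 1 ≤ p) : ∀ᵐ y, 0 < ω y := by
  obtain ⟨n₀, hn₀⟩ : ∃ n : ℕ,
      ∫⁻ y in ball (0 : EuclideanSpace ℝ (Fin d)) n, ENNReal.ofReal (ω y) ≠ 0 := by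
    by_contra! hcon
    refine h.1.ne_zero ?_
    have h1 : ∀ n : ℕ, ∀ᵐ y, y ∈ ball (0 : EuclideanSpace ℝ (Fin d)) n → ω y = 0 := by
      intro n
      have := (lintegral_eq_zero_iff' h.1.aemeasurable.restrict).1 (hcon n)
      rw [Filter.EventuallyEq, ae_restrict_iff' measurableSet_ball] at this
      filter_upwards [this] with y hy hyn
      exact le_antisymm (ENNReal.ofReal_eq_zero.1 (hy hyn)) (h.1.nonneg y)
    filter_upwards [ae_all_iff.2 h1] with y hy
    obtain ⟨n, hn⟩ := exists_nat_gt ‖y‖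
    exact hy n (by simpa using hn)
  have h1 : ∀ n : ℕ, ∀ᵐ y, y ∈ ball (0 : EuclideanSpace ℝ (Fin d)) n → 0 < ω y := by
    intro n
    have hsub : ball (0 : EuclideanSpace ℝ (Fin d)) n₀ ⊆ ball 0 ((max n n₀ : ℕ) + 1) :=
      ball_subset_ball (by push_cast; linarith [le_max_right (n : ℝ) n₀])
    have hne : ∫⁻ y in ball (0 : EuclideanSpace ℝ (Fin d)) ((max n n₀ : ℕ) + 1),
        ENNReal.ofReal (ω y) ≠ 0 :=
      fun h0 => hn₀ (le_antisymm ((lintegral_mono_set hsub).trans_eq h0) zero_le)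
    have := h.ae_pos_on_ball hp (by positivity) hne
    rw [ae_restrict_iff' measurableSet_ball] at this
    filter_upwards [this] with y hy hyn
    exact hy (ball_subset_ball (by push_cast; linarith [le_max_left (n : ℝ) n₀]) hyn)
  filter_upwards [ae_all_iff.2 h1] with y hy
  obtain ⟨n, hn⟩ := exists_nat_gt ‖y‖
  exact hy n (by simpa using hn)

lemma lintegral_ne_zero (h : IsApWeight ρ θ p ω) (hp : 1 ≤ p) (x : EuclideanSpace ℝ (Fin d))
    {r : ℝ} (hr : 0 < r) : ∫⁻ y in ball x r, ENNReal.ofReal (ω y) ≠ 0 := by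
  intro h0
  have h1 := (lintegral_eq_zero_iff' h.1.aemeasurable.restrict).1 h0
  have := (ae_neBot.2 (restrict_ball_ne_zero x hr))
  obtain ⟨y, hy1, hy2⟩ := (h1.and (ae_restrict_of_ae (h.ae_pos hp))).exists
  exact (ENNReal.ofReal_pos.2 hy2).ne' hy1

lemma essInf_ne_zero (h : IsApWeight ρ θ 1 ω) (x : EuclideanSpace ℝ (Fin d))
    {r : ℝ} (hr : 0 < r) :
    essInf (fun x => ENNReal.ofReal (ω x)) (volume.restrict (ball x r)) ≠ 0 := by
  obtain ⟨C, hC, hA⟩ := h.2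
  have hx := hA x r hr
  rw [if_pos rfl] at hx
  intro he
  rw [he, mul_zero] at hx
  exact ballAverage_ne_zero (h.lintegral_ne_zero le_rfl x hr) (le_antisymm hx zero_le)

lemma essInf_ne_top (x : EuclideanSpace ℝ (Fin d)) {r : ℝ} (hr : 0 < r) :
    essInf (fun x => ENNReal.ofReal (ω x)) (volume.restrict (ball x r)) ≠ ∞ := by
  intro he
  have := (ae_neBot.2 (restrict_ball_ne_zero x hr))
  obtain ⟨y, hy⟩ := (ae_essInf_le (f := fun x => ENNReal.ofReal (ω x))
      (μ := volume.restrict (ball x r))).exists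
  rw [he, top_le_iff] at hy
  exact ENNReal.ofReal_ne_top hy

lemma apCharacteristic_ne_top (h : IsApWeight ρ θ p ω) (hρ : ∀ x, 0 < ρ x) :
    apCharacteristic ρ θ p ω ≠ ∞ := by
  obtain ⟨C, hC, hA⟩ := h.2
  suffices apCharacteristic ρ θ p ω ≤ ENNReal.ofReal C from
    ne_top_of_le_ne_top ENNReal.ofReal_ne_top this
  refine iSup_le fun x => iSup_le fun r => iSup_le fun hr => ?_
  have hx := hA x r hr
  have hu : 0 < 1 + r / ρ x := by have := hρ x; positivity
  have hQ : (if p = 1 then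
        (ballAverage x r fun x => ENNReal.ofReal (ω x))
          * (essInf (fun x => ENNReal.ofReal (ω x)) (volume.restrict (ball x r)))⁻¹
      else
        (ballAverage x r fun x => ENNReal.ofReal (ω x)) ^ (1 / p)
          * (ballAverage x r fun x => ENNReal.ofReal (ω x) ^ (-(p.conjExponent / p)))
              ^ (1 / p.conjExponent)) ≤ ENNReal.ofReal (C * (1 + r / ρ x) ^ θ) := by
    split_ifs at hx ⊢ with hp1
    · subst hp1
      rw [← div_eq_mul_inv]
      exact ENNReal.div_le_of_le_mul hx
    · exact hx
  refine (mul_le_mul_right hQ _).trans_eq ?_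
  rw [← ENNReal.ofReal_mul (by positivity), mul_left_comm, ← Real.rpow_add hu]
  simp

/-- Hölder's inequality against an `A_p` weight. -/
lemma ballAverage_le (h : IsApWeight ρ θ p ω) (hp : 1 ≤ p) (x : EuclideanSpace ℝ (Fin d))
    {r : ℝ} (hr : 0 < r) {g : EuclideanSpace ℝ (Fin d) → ℝ≥0∞}
    (hg : AEMeasurable g volume) :
    ballAverage x r g ≤ ((∫⁻ x in ball x r, ENNReal.ofReal (ω x))⁻¹ *
      ∫⁻ x in ball x r, g x ^ p * ENNReal.ofReal (ω x)) ^ (1 / p) * apBallConst p ω x r := by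
  have h0 := h.lintegral_ne_zero hp x hr
  have htop := (lintegral_ofReal_ball_lt_top h.1.locallyIntegrable x r).ne
  set W := ∫⁻ x in ball x r, ENNReal.ofReal (ω x) with hW
  have hpos := ae_restrict_of_ae (s := ball x r) (h.ae_pos hp)
  rw [apBallConst]
  split_ifs with hp1
  · subst hp1
    have he0 := h.essInf_ne_zero x hr
    have het := essInf_ne_top (ω := ω) x hr
    set e := essInf (fun x => ENNReal.ofReal (ω x)) (volume.restrict (ball x r)) with he
    have h1 : ∫⁻ y in ball x r, g y ≤
        e⁻¹ * ∫⁻ y in ball x r, g y ^ (1 : ℝ) * ENNReal.ofReal (ω y) := by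
      rw [← lintegral_const_mul' _ _ (ENNReal.inv_ne_top.2 he0)]
      refine lintegral_mono_ae ?_
      filter_upwards [ae_essInf_le (f := fun x => ENNReal.ofReal (ω x))
        (μ := volume.restrict (ball x r))] with y hy
      calc g y = e⁻¹ * (g y * e) := by
            rw [mul_left_comm, ENNReal.inv_mul_cancel he0 het, mul_one]
        _ ≤ e⁻¹ * (g y ^ (1 : ℝ) * ENNReal.ofReal (ω y)) := by
            rw [ENNReal.rpow_one]; gcongr
    rw [ballAverage, ballAverage, ← hW, div_one, ENNReal.rpow_one]
    calc (volume (ball x r))⁻¹ * ∫⁻ y in ball x r, g y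
        ≤ (volume (ball x r))⁻¹ *
          (e⁻¹ * ∫⁻ y in ball x r, g y ^ (1 : ℝ) * ENNReal.ofReal (ω y)) := by gcongr
      _ = (W⁻¹ * W) * ((volume (ball x r))⁻¹ *
          (e⁻¹ * ∫⁻ y in ball x r, g y ^ (1 : ℝ) * ENNReal.ofReal (ω y))) := by
        rw [ENNReal.inv_mul_cancel h0 htop, one_mul]
      _ = _ := by ring
  · have hp' : 1 < p := lt_of_le_of_ne hp (Ne.symm hp1)
    have hconj := Real.HolderConjugate.conjExponent hp'
    have hp0 := hconj.pos
    have hp0' := hconj.symm.pos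
    have hsum : 1 / p + 1 / p.conjExponent = 1 := by
      simpa using hconj.inv_add_inv_eq_one
    -- Splitting `g = (g ω^{1/p}) · ω^{-1/p}` is legitimate because `ω > 0` a.e.
    have h1 := ENNReal.lintegral_mul_le_Lp_mul_Lq (volume.restrict (ball x r)) hconj
      (f := fun y => g y * ENNReal.ofReal (ω y) ^ (1 / p))
      (g := fun y => ENNReal.ofReal (ω y) ^ (-(1 / p)))
      (hg.restrict.mul (h.1.aemeasurable.restrict.pow_const _))
      (h.1.aemeasurable.restrict.pow_const _)
    have h2 : ∫⁻ y in ball x r, g y = ∫⁻ y in ball x r,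
        ((fun y => g y * ENNReal.ofReal (ω y) ^ (1 / p)) *
          (fun y => ENNReal.ofReal (ω y) ^ (-(1 / p)))) y := by
      refine lintegral_congr_ae ?_
      filter_upwards [hpos] with y hy
      rw [Pi.mul_apply, mul_assoc, ← ENNReal.rpow_add _ _ (ENNReal.ofReal_pos.2 hy).ne'
        ENNReal.ofReal_ne_top]
      simp
    have h3 : ∀ y, (g y * ENNReal.ofReal (ω y) ^ (1 / p)) ^ p =
        g y ^ p * ENNReal.ofReal (ω y) := fun y => by
      rw [ENNReal.mul_rpow_of_nonneg _ _ hp0.le, ← ENNReal.rpow_mul,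
        one_div_mul_cancel hp0.ne', ENNReal.rpow_one]
    have h4 : ∀ y, (ENNReal.ofReal (ω y) ^ (-(1 / p))) ^ p.conjExponent =
        ENNReal.ofReal (ω y) ^ (-(p.conjExponent / p)) := fun y => by
      rw [← ENNReal.rpow_mul]; congr 1; ring
    simp only [h3, h4] at h1
    rw [← h2] at h1
    have hq0 : 0 ≤ 1 / p := by positivity
    have hq0' : 0 ≤ 1 / p.conjExponent := by positivity
    have hB0 := (measure_ball_pos volume x hr).ne'
    have hBt : volume (ball x r) ≠ ∞ := measure_ball_lt_top.ne
    simp only [ballAverage, ← hW]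
    rw [ENNReal.mul_rpow_of_nonneg _ _ hq0, ENNReal.mul_rpow_of_nonneg _ _ hq0,
      ENNReal.mul_rpow_of_nonneg _ _ hq0']
    have hvol : (volume (ball x r))⁻¹ =
        (volume (ball x r))⁻¹ ^ (1 / p) * (volume (ball x r))⁻¹ ^ (1 / p.conjExponent) := by
      rw [← ENNReal.rpow_add_of_nonneg _ _ hq0 hq0', hsum, ENNReal.rpow_one]
    have hWW : W⁻¹ ^ (1 / p) * W ^ (1 / p) = 1 := by
      rw [← ENNReal.mul_rpow_of_nonneg _ _ hq0, ENNReal.inv_mul_cancel h0 htop, ENNReal.one_rpow]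
    calc (volume (ball x r))⁻¹ * ∫⁻ y in ball x r, g y
        ≤ (volume (ball x r))⁻¹ * _ := mul_le_mul_right h1 _
      _ = (W⁻¹ ^ (1 / p) * W ^ (1 / p)) *
          ((volume (ball x r))⁻¹ ^ (1 / p) * (volume (ball x r))⁻¹ ^ (1 / p.conjExponent)) * _ := by
        rw [hWW, one_mul, ← hvol]
      _ = _ := by ring

lemma one_le_apBallConst (h : IsApWeight ρ θ p ω) (hp : 1 ≤ p) (x : EuclideanSpace ℝ (Fin d))
    {r : ℝ} (hr : 0 < r) : 1 ≤ apBallConst p ω x r := by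
  have h1 := h.ballAverage_le hp x hr (g := fun _ => 1) aemeasurable_const
  have h0 := h.lintegral_ne_zero hp x hr
  have htop := (lintegral_ofReal_ball_lt_top h.1.locallyIntegrable x r).ne
  simpa [ballAverage, ENNReal.inv_mul_cancel h0 htop,
    ENNReal.inv_mul_cancel (measure_ball_pos volume x hr).ne' measure_ball_lt_top.ne] using h1

/-- Each ball quantity is at least `1` (Hölder with `g = 1`), and the normalising factor tends to
`1` as `r → 0`. -/
lemma one_le_apCharacteristic (h : IsApWeight ρ θ p ω) (hp : 1 ≤ p) :
    1 ≤ apCharacteristic ρ θ p ω := by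
  have hlim : Filter.Tendsto (fun r : ℝ => ENNReal.ofReal ((1 + r / ρ 0) ^ (-θ)))
      (nhdsWithin 0 (Set.Ioi 0)) (nhds 1) := by
    have hc : ContinuousAt (fun r : ℝ => ENNReal.ofReal ((1 + r / ρ 0) ^ (-θ))) 0 := by
      refine ENNReal.continuous_ofReal.continuousAt.comp ?_
      refine ContinuousAt.rpow_const (by fun_prop) (Or.inl (by simp))
    simpa using hc.tendsto.mono_left nhdsWithin_le_nhds
  refine le_of_tendsto hlim ?_
  filter_upwards [self_mem_nhdsWithin] with r hr
  refine le_trans ?_ (mul_apBallConst_le ρ θ p ω 0 hr)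
  exact le_mul_of_one_le_right' (h.one_le_apBallConst hp 0 hr)

end IsApWeight

end Weights

/-! ### Finiteness of the essential infimum and integrability -/

section LowerOsc

variable {d : ℕ} {ρ f : EuclideanSpace ℝ (Fin d) → ℝ} {β θ : ℝ}

lemma aemeasurable_lowerOsc (hf : AEMeasurable f volume) (B : Set (EuclideanSpace ℝ (Fin d))) :
    AEMeasurable (lowerOsc f B) volume := by
  unfold lowerOsc
  simp only [sub_eq_add_neg]
  exact (hf.coe_real_ereal.add_const _).ereal_toENNReal

/-- The essential infimum of `f` on the ball `B(x, r)` as a real number. -/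
noncomputable def ballEssInf (f : EuclideanSpace ℝ (Fin d) → ℝ) (x : EuclideanSpace ℝ (Fin d))
    (r : ℝ) : ℝ :=
  (essInf (fun y => (f y : EReal)) (volume.restrict (ball x r))).toReal

/-- The value `∞` is impossible for a real function on a set of positive measure; the value `-∞`
would make the lower oscillation identically `∞`. -/
lemma coe_ballEssInf {x : EuclideanSpace ℝ (Fin d)} {r : ℝ} (hr : 0 < r)
    (h : ∫⁻ y in ball x r, lowerOsc f (ball x r) y ≠ ∞) :
    (ballEssInf f x r : EReal) = essInf (fun y => (f y : EReal)) (volume.restrict (ball x r)) := by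
  refine EReal.coe_toReal (fun htop => ?_) (fun hbot => h ?_)
  · have := (ae_neBot.2 (restrict_ball_ne_zero x hr))
    obtain ⟨y, hy⟩ := (ae_essInf_le (f := fun y => (f y : EReal))
      (μ := volume.restrict (ball x r))).exists
    rw [htop, top_le_iff] at hy
    exact EReal.coe_ne_top _ hy
  · simp only [lowerOsc, hbot, EReal.coe_sub_bot, EReal.toENNReal_top, lintegral_const]
    exact ENNReal.top_mul (by simpa using (measure_ball_pos volume x hr).ne')

lemma lowerOsc_ball_eq {x : EuclideanSpace ℝ (Fin d)} {r : ℝ} (hr : 0 < r)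
    (h : ∫⁻ y in ball x r, lowerOsc f (ball x r) y ≠ ∞) (y : EuclideanSpace ℝ (Fin d)) :
    lowerOsc f (ball x r) y = ENNReal.ofReal (f y - ballEssInf f x r) := by
  rw [lowerOsc, ← coe_ballEssInf hr h, ← EReal.coe_sub, EReal.toENNReal_of_ne_top
    (EReal.coe_ne_top _), EReal.toReal_coe]

lemma ae_ballEssInf_le {x : EuclideanSpace ℝ (Fin d)} {r : ℝ} (hr : 0 < r)
    (h : ∫⁻ y in ball x r, lowerOsc f (ball x r) y ≠ ∞) :
    ∀ᵐ y ∂volume.restrict (ball x r), ballEssInf f x r ≤ f y := by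
  filter_upwards [ae_essInf_le (f := fun y => (f y : EReal))
      (μ := volume.restrict (ball x r))] with y hy
  rw [← coe_ballEssInf hr h] at hy
  exact_mod_cast hy

lemma integrableOn_ball_of_lowerOsc (hf : AEMeasurable f volume)
    {x : EuclideanSpace ℝ (Fin d)} {r : ℝ} (hr : 0 < r)
    (h : ∫⁻ y in ball x r, lowerOsc f (ball x r) y ≠ ∞) : IntegrableOn f (ball x r) volume := by
  have h1 : IntegrableOn (fun y => f y - ballEssInf f x r) (ball x r) volume := by
    refine ⟨(hf.sub_const _).aestronglyMeasurable.restrict, ?_⟩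
    rw [hasFiniteIntegral_iff_ofReal]
    · simp only [← lowerOsc_ball_eq hr h]
      exact h.lt_top
    · filter_upwards [ae_ballEssInf_le hr h] with y hy using sub_nonneg.2 hy
  have h2 : IntegrableOn (fun _ => ballEssInf f x r) (ball x r) volume :=
    integrableOn_const measure_ball_lt_top.ne
  exact (h1.add h2).congr (Filter.Eventually.of_forall fun y => by simp)

lemma mul_lintegral_lowerOsc_le (ρ : EuclideanSpace ℝ (Fin d) → ℝ) (β θ : ℝ)
    (f : EuclideanSpace ℝ (Fin d) → ℝ) (x : EuclideanSpace ℝ (Fin d)) {r : ℝ} (hr : 0 < r) :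
    ENNReal.ofReal ((1 + r / ρ x) ^ (-θ)) *
      (volume (ball x r) ^ (-(1 + β / d)) * ∫⁻ y in ball x r, lowerOsc f (ball x r) y) ≤
        campanatoConst ρ β θ f :=
  le_iSup_of_le x (le_iSup_of_le r (le_iSup_of_le hr le_rfl))

lemma lintegral_lowerOsc_ne_top (hρ : ∀ x, 0 < ρ x) (h : campanatoConst ρ β θ f < ∞)
    (x : EuclideanSpace ℝ (Fin d)) {r : ℝ} (hr : 0 < r) :
    ∫⁻ y in ball x r, lowerOsc f (ball x r) y ≠ ∞ := by
  intro htop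
  have h1 := mul_lintegral_lowerOsc_le ρ β θ f x hr
  have hu : 0 < 1 + r / ρ x := by have := hρ x; positivity
  rw [htop, ENNReal.mul_top, ENNReal.mul_top] at h1
  · exact absurd (h1.trans_lt h) (lt_irrefl _)
  · exact (ENNReal.ofReal_pos.2 (by positivity)).ne'
  · exact (ENNReal.rpow_pos (measure_ball_pos _ _ hr) measure_ball_lt_top.ne).ne'

end LowerOsc

/-! ### Pointwise bound for the lower oscillation of Campanato functions -/

/-- The constant in the pointwise bound for the lower oscillation. -/
noncomputable def oscConst (d : ℕ) (β : ℝ) : ℝ := 2 ^ d / (1 - 2 ^ (-β)) + 1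

lemma two_rpow_neg_lt_one {β : ℝ} (hβ : 0 < β) : (2 : ℝ) ^ (-β) < 1 :=
  Real.rpow_lt_one_of_one_lt_of_neg one_lt_two (neg_lt_zero.2 hβ)

lemma oscConst_pos (d : ℕ) {β : ℝ} (hβ : 0 < β) : 0 < oscConst d β := by
  have := two_rpow_neg_lt_one hβ
  have h2 : 0 < 1 - (2 : ℝ) ^ (-β) := by linarith
  unfold oscConst
  positivity

lemma volumeReal_ball_div_two_pow_rpow {d : ℕ} {β : ℝ} (hd : d ≠ 0)
    (x : EuclideanSpace ℝ (Fin d)) {r : ℝ} (hr : 0 < r) (k : ℕ) :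
    volume.real (ball x (r / 2 ^ k)) ^ (β / d) =
      (2 ^ (-β)) ^ k * volume.real (ball x r) ^ (β / d) := by
  have hk : (0 : ℝ) < 2 ^ k := by positivity
  have h1 : volume.real (ball x (r / 2 ^ k)) = (2 ^ k)⁻¹ ^ d * volume.real (ball x r) := by
    rw [volumeReal_ball x hr, volumeReal_ball x (by positivity : 0 < r / 2 ^ k), div_pow, inv_pow]
    field_simp
  have hd' : (d : ℝ) ≠ 0 := by exact_mod_cast hd
  rw [h1, Real.mul_rpow (by positivity) measureReal_nonneg]
  congr 1
  rw [← Real.rpow_natCast, ← Real.rpow_mul (by positivity), mul_div_cancel₀ _ hd',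
    Real.inv_rpow hk.le, ← Real.rpow_neg hk.le, ← Real.rpow_natCast, ← Real.rpow_natCast,
    ← Real.rpow_mul two_pos.le, ← Real.rpow_mul two_pos.le, mul_comm]

namespace MemCampanato

variable {d : ℕ} {ρ f : EuclideanSpace ℝ (Fin d) → ℝ} {β θ : ℝ}

lemma integrableOn_ball (h : MemCampanato ρ β θ f) (x : EuclideanSpace ℝ (Fin d)) (r : ℝ) :
    IntegrableOn f (ball x r) volume :=
  (h.1.integrableOn_isCompact (isCompact_closedBall x r)).mono_set ball_subset_closedBall

lemma ballEssInf_anti (h : MemCampanato ρ β θ f) (hρ : ∀ x, 0 < ρ x)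
    {x y : EuclideanSpace ℝ (Fin d)} {r s : ℝ} (hr : 0 < r) (hs : 0 < s)
    (hsub : ball x r ⊆ ball y s) : ballEssInf f y s ≤ ballEssInf f x r := by
  rw [← EReal.coe_le_coe_iff, coe_ballEssInf hr (lintegral_lowerOsc_ne_top hρ h.2 x hr),
    coe_ballEssInf hs (lintegral_lowerOsc_ne_top hρ h.2 y hs)]
  exact essInf_antitone_measure (Measure.absolutelyContinuous_of_le
    (Measure.restrict_mono_set volume hsub))

lemma ballEssInf_le_average (h : MemCampanato ρ β θ f) (hρ : ∀ x, 0 < ρ x)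
    (x : EuclideanSpace ℝ (Fin d)) {r : ℝ} (hr : 0 < r) :
    ballEssInf f x r ≤ (volume.real (ball x r))⁻¹ * ∫ y in ball x r, f y := by
  rw [← div_eq_inv_mul, le_div_iff₀ (volumeReal_ball_pos x hr), mul_comm]
  calc volume.real (ball x r) * ballEssInf f x r = ∫ y in ball x r, ballEssInf f x r := by simp
    _ ≤ ∫ y in ball x r, f y :=
      integral_mono_ae (integrableOn_const measure_ball_lt_top.ne) (h.integrableOn_ball x r)
        (ae_ballEssInf_le hr (lintegral_lowerOsc_ne_top hρ h.2 x hr))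

lemma integral_sub_ballEssInf_le (h : MemCampanato ρ β θ f) (hρ : ∀ x, 0 < ρ x)
    (x : EuclideanSpace ℝ (Fin d)) {r : ℝ} (hr : 0 < r) :
    (volume.real (ball x r))⁻¹ * ∫ y in ball x r, (f y - ballEssInf f x r) ≤
      (campanatoConst ρ β θ f).toReal * (1 + r / ρ x) ^ θ * volume.real (ball x r) ^ (β / d) := by
  have hfin := lintegral_lowerOsc_ne_top hρ h.2 x hr
  have hB := volumeReal_ball_pos x hr
  have hu : 0 < 1 + r / ρ x := by have := hρ x; positivity
  have hI : ∫ y in ball x r, (f y - ballEssInf f x r) =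
      (∫⁻ y in ball x r, lowerOsc f (ball x r) y).toReal := by
    rw [integral_eq_lintegral_of_nonneg_ae]
    · simp only [lowerOsc_ball_eq hr hfin]
    · filter_upwards [ae_ballEssInf_le hr hfin] with y hy using sub_nonneg.2 hy
    · exact (h.1.aestronglyMeasurable.sub aestronglyMeasurable_const).restrict
  have h1 := ENNReal.toReal_mono h.2.ne (mul_lintegral_lowerOsc_le ρ β θ f x hr)
  rw [ENNReal.toReal_mul, ENNReal.toReal_mul, ENNReal.toReal_ofReal (by positivity),
    ← ENNReal.toReal_rpow, ← hI] at h1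
  change (1 + r / ρ x) ^ (-θ) * (volume.real (ball x r) ^ (-(1 + β / d)) * _) ≤ _ at h1
  rw [Real.rpow_neg hu.le, inv_mul_le_iff₀ (by positivity), Real.rpow_neg hB.le,
    inv_mul_le_iff₀ (by positivity), Real.rpow_add hB, Real.rpow_one] at h1
  rw [inv_mul_le_iff₀ hB]
  linarith

/-- The infimum over the half ball is at most the mean there, and the mean of the nonnegative
function `f - ess inf_B f` over the half ball is at most `2 ^ d` times its mean over the full ball.
-/
lemma ballEssInf_half_sub_le (h : MemCampanato ρ β θ f) (hρ : ∀ x, 0 < ρ x)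
    (x : EuclideanSpace ℝ (Fin d)) {r : ℝ} (hr : 0 < r) :
    ballEssInf f x (r / 2) - ballEssInf f x r ≤ 2 ^ d * ((campanatoConst ρ β θ f).toReal *
      (1 + r / ρ x) ^ θ * volume.real (ball x r) ^ (β / d)) := by
  have hr2 : 0 < r / 2 := by positivity
  have hB := volumeReal_ball_pos x hr
  have hB2 := volumeReal_ball_pos x hr2
  have hsub : ball x (r / 2) ⊆ ball x r := ball_subset_ball (by linarith)
  have hvol : volume.real (ball x r) = 2 ^ d * volume.real (ball x (r / 2)) := by
    rw [volumeReal_ball x hr, volumeReal_ball x hr2, div_pow]; field_simp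
  have hint : IntegrableOn (fun y => f y - ballEssInf f x r) (ball x r) volume :=
    (h.integrableOn_ball x r).sub (integrableOn_const measure_ball_lt_top.ne)
  calc ballEssInf f x (r / 2) - ballEssInf f x r
      ≤ (volume.real (ball x (r / 2)))⁻¹ * ∫ y in ball x (r / 2), f y - ballEssInf f x r := by
        rw [integral_sub (h.integrableOn_ball x _) (integrableOn_const measure_ball_lt_top.ne),
          setIntegral_const, smul_eq_mul, mul_sub, inv_mul_cancel_left₀ hB2.ne']
        linarith [h.ballEssInf_le_average hρ x hr2]
    _ ≤ (volume.real (ball x (r / 2)))⁻¹ * ∫ y in ball x r, f y - ballEssInf f x r := by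
        refine mul_le_mul_of_nonneg_left (setIntegral_mono_set hint ?_
          (Filter.Eventually.of_forall hsub)) (by positivity)
        filter_upwards [ae_ballEssInf_le hr (lintegral_lowerOsc_ne_top hρ h.2 x hr)] with y hy
          using sub_nonneg.2 hy
    _ = 2 ^ d * ((volume.real (ball x r))⁻¹ * ∫ y in ball x r, f y - ballEssInf f x r) := by
        rw [hvol]; field_simp
    _ ≤ _ := mul_le_mul_of_nonneg_left (h.integral_sub_ballEssInf_le hρ x hr) (by positivity)

/-- Telescoping the infima over halved balls gives a geometric series of ratio `2 ^ (-β)`. Passing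
from the infimum to the mean on the last ball accounts for the `+ 1` in `oscConst`. -/
lemma average_le (h : MemCampanato ρ β θ f) (hρ : ∀ x, 0 < ρ x) (hd : d ≠ 0) (hβ : 0 < β)
    (hθ : 0 < θ) (x : EuclideanSpace ℝ (Fin d)) {r : ℝ} (hr : 0 < r) (k : ℕ) :
    (volume.real (ball x (r / 2 ^ k)))⁻¹ * ∫ y in ball x (r / 2 ^ k), f y ≤
      ballEssInf f x r + oscConst d β * ((campanatoConst ρ β θ f).toReal *
        (1 + r / ρ x) ^ θ * volume.real (ball x r) ^ (β / d)) := by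
  have hρx := hρ x
  have hb := two_rpow_neg_lt_one hβ
  have hb0 : (0 : ℝ) < 2 ^ (-β) := by positivity
  set b : ℝ := 2 ^ (-β) with hbdef
  set A := (campanatoConst ρ β θ f).toReal * (1 + r / ρ x) ^ θ * volume.real (ball x r) ^ (β / d)
    with hA
  have hA0 : 0 ≤ A := by positivity
  have h1b : 0 < 1 - b := by linarith
  have hterm : ∀ j : ℕ, (campanatoConst ρ β θ f).toReal * (1 + r / 2 ^ j / ρ x) ^ θ *
      volume.real (ball x (r / 2 ^ j)) ^ (β / d) ≤ b ^ j * A := by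
    intro j
    rw [volumeReal_ball_div_two_pow_rpow hd x hr, hA]
    have hle : r / 2 ^ j ≤ r := div_le_self hr.le (one_le_pow₀ one_le_two)
    calc (campanatoConst ρ β θ f).toReal * (1 + r / 2 ^ j / ρ x) ^ θ *
          (b ^ j * volume.real (ball x r) ^ (β / d))
        ≤ (campanatoConst ρ β θ f).toReal * (1 + r / ρ x) ^ θ *
          (b ^ j * volume.real (ball x r) ^ (β / d)) := by gcongr
      _ = _ := by ring
  have hind : ∀ j : ℕ, ballEssInf f x (r / 2 ^ j) ≤
      ballEssInf f x r + 2 ^ d * A * ((1 - b ^ j) / (1 - b)) := by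
    intro j
    induction j with
    | zero => simp
    | succ j ih =>
      have hs := h.ballEssInf_half_sub_le hρ x (r := r / 2 ^ j) (by positivity)
      rw [show r / 2 ^ j / 2 = r / 2 ^ (j + 1) by rw [pow_succ, div_div]] at hs
      have ht := mul_le_mul_of_nonneg_left (hterm j) (by positivity : (0 : ℝ) ≤ 2 ^ d)
      have he : 2 ^ d * A * ((1 - b ^ (j + 1)) / (1 - b)) =
          2 ^ d * A * ((1 - b ^ j) / (1 - b)) + 2 ^ d * (b ^ j * A) := by
        field_simp; ring
      linarith
  have hrk : 0 < r / 2 ^ k := by positivity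
  have hBk := volumeReal_ball_pos x hrk
  have hlast := (h.integral_sub_ballEssInf_le hρ x hrk).trans (hterm k)
  rw [integral_sub (h.integrableOn_ball x _) (integrableOn_const measure_ball_lt_top.ne),
    setIntegral_const, smul_eq_mul, mul_sub, inv_mul_cancel_left₀ hBk.ne'] at hlast
  have hbk : b ^ k ≤ 1 := pow_le_one₀ hb0.le hb.le
  have hbk0 : 0 ≤ b ^ k := by positivity
  have h2 : 2 ^ d * A * ((1 - b ^ k) / (1 - b)) ≤ 2 ^ d * A * (1 / (1 - b)) := by
    gcongr
    linarith
  have h3 : b ^ k * A ≤ A := mul_le_of_le_one_left hA0 hbk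
  have h4 : oscConst d β * A = 2 ^ d * A * (1 / (1 - b)) + A := by
    rw [oscConst, ← hbdef]; ring
  linarith [hind k]

/-- Let `k → ∞` in the bound on means and use Lebesgue differentiation; the exceptional null set
does not depend on `r`. -/
lemma ae_le (h : MemCampanato ρ β θ f) (hρ : ∀ x, 0 < ρ x) (hd : d ≠ 0) (hβ : 0 < β)
    (hθ : 0 < θ) : ∀ᵐ x, ∀ r, 0 < r → f x ≤
      ballEssInf f x r + oscConst d β * ((campanatoConst ρ β θ f).toReal *
        (1 + r / ρ x) ^ θ * volume.real (ball x r) ^ (β / d)) := by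
  filter_upwards [IsUnifLocDoublingMeasure.ae_tendsto_average volume h.1 1] with x hx r hr
  have hlim : Filter.Tendsto (fun k : ℕ => r / 2 ^ k) Filter.atTop (nhdsWithin 0 (Set.Ioi 0)) := by
    refine tendsto_nhdsWithin_iff.2 ⟨?_, Filter.Eventually.of_forall fun k => ?_⟩
    · have := (tendsto_pow_atTop_nhds_zero_of_lt_one (r := (1 / 2 : ℝ)) (by norm_num)
        (by norm_num)).const_mul r
      simpa [div_eq_mul_inv] using this
    · show 0 < r / 2 ^ k
      positivity
  have h1 := hx (fun _ : ℕ => x) (fun k : ℕ => r / 2 ^ k) hlim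
    (Filter.Eventually.of_forall fun k => mem_closedBall_self (by positivity))
  refine le_of_tendsto h1 (Filter.Eventually.of_forall fun k => ?_)
  have hrk : r / 2 ^ k ≠ 0 := by positivity
  have hae : closedBall x (r / 2 ^ k) =ᵐ[volume] ball x (r / 2 ^ k) := by
    rw [← ball_union_sphere]
    exact union_ae_eq_left_of_ae_eq_empty
      (ae_eq_empty.2 (Measure.addHaar_sphere_of_ne_zero volume x hrk))
  rw [setAverage_congr hae, setAverage_eq, smul_eq_mul]
  exact h.average_le hρ hd hβ hθ x hr k

/-- Pointwise bound for the lower oscillation on a ball. -/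
lemma ae_lowerOsc_le (h : MemCampanato ρ β θ f) (hρ : ∀ x, 0 < ρ x) (hd : d ≠ 0) (hβ : 0 < β)
    (hθ : 0 < θ) {C₀ N₀ : ℝ} (hC : IsComparisonPair ρ C₀ N₀) (x : EuclideanSpace ℝ (Fin d))
    {r : ℝ} (hr : 0 < r) :
    ∀ᵐ y ∂volume.restrict (ball x r), f y - ballEssInf f x r ≤
      (oscConst d β * (4 * C₀) ^ θ * 2 ^ β) * (campanatoConst ρ β θ f).toReal *
        (1 + r / ρ x) ^ ((N₀ + 1) * θ) * volume.real (ball x r) ^ (β / d) := by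
  obtain ⟨hC1, hN, hcmp⟩ := hC
  have hK := oscConst_pos d hβ
  filter_upwards [ae_restrict_of_ae (h.ae_le hρ hd hβ hθ), ae_restrict_mem measurableSet_ball]
    with y hy hyB
  have hx := hρ x
  have hyp := hρ y
  have hr2 : 0 < 2 * r := by positivity
  -- The bound is applied on the ball of radius `2r` about `y` itself: it contains `B(x, r)`, so its
  -- infimum is no larger.
  have hsub : ball x r ⊆ ball y (2 * r) := ball_subset_ball' (by
    have := mem_ball'.1 hyB
    linarith)
  have h1 := hy (2 * r) hr2
  have h2 := h.ballEssInf_anti hρ hr hr2 hsub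
  set u := 1 + r / ρ x with hu
  have hu1 : 1 ≤ u := le_add_of_nonneg_right (by positivity)
  have hu0 : 0 < u := by linarith
  -- The lower comparison gives `ρ x / ρ y ≤ C₀ u ^ N₀`; multiplied by `r / ρ x ≤ u` it yields the
  -- exponent `N₀ + 1`.
  have h3 : 1 + 2 * r / ρ y ≤ 4 * C₀ * u ^ (N₀ + 1) := by
    have h4 : 1 / C₀ * u ^ (-N₀) ≤ ρ y / ρ x := by
      refine le_trans ?_ (hcmp x y).1
      refine mul_le_mul_of_nonneg_left ?_ (by positivity)
      refine Real.rpow_le_rpow_of_nonpos (by positivity) ?_ (by linarith)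
      rw [hu]
      gcongr
      exact (mem_ball'.1 hyB).le
    have huN : 1 ≤ u ^ (N₀ + 1) := Real.one_le_rpow hu1 (by linarith)
    have huN0 : 0 < u ^ N₀ := by positivity
    rw [Real.rpow_neg hu0.le, one_div, ← mul_inv, inv_le_comm₀ (by positivity) (by positivity),
      inv_div] at h4
    have h5 : r / ρ y ≤ C₀ * u ^ (N₀ + 1) := by
      calc r / ρ y = (ρ x / ρ y) * (r / ρ x) := by field_simp
        _ ≤ (C₀ * u ^ N₀) * u := by
          gcongr
          rw [hu]; linarith
        _ = _ := by rw [Real.rpow_add hu0, Real.rpow_one]; ring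
    have h6 : 1 ≤ C₀ * u ^ (N₀ + 1) := by nlinarith
    rw [mul_div_assoc]
    linarith
  have h7 : (1 + 2 * r / ρ y) ^ θ ≤ (4 * C₀) ^ θ * u ^ ((N₀ + 1) * θ) := by
    have := Real.rpow_le_rpow (by positivity) h3 hθ.le
    rwa [Real.mul_rpow (by positivity) (by positivity), ← Real.rpow_mul hu0.le] at this
  have h8 : volume.real (ball y (2 * r)) ^ (β / d) = 2 ^ β * volume.real (ball x r) ^ (β / d) := by
    have hd' : (d : ℝ) ≠ 0 := by exact_mod_cast hd
    rw [volumeReal_ball y hr2, mul_pow, mul_assoc, ← volumeReal_ball x hr,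
      Real.mul_rpow (by positivity) measureReal_nonneg, ← Real.rpow_natCast,
      ← Real.rpow_mul two_pos.le, mul_div_cancel₀ _ hd']
  rw [h8] at h1
  calc f y - ballEssInf f x r
      ≤ oscConst d β * ((campanatoConst ρ β θ f).toReal * (1 + 2 * r / ρ y) ^ θ *
        (2 ^ β * volume.real (ball x r) ^ (β / d))) := by linarith
    _ ≤ oscConst d β * ((campanatoConst ρ β θ f).toReal * ((4 * C₀) ^ θ * u ^ ((N₀ + 1) * θ)) *
        (2 ^ β * volume.real (ball x r) ^ (β / d))) := by gcongr
    _ = _ := by ring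

end MemCampanato

/-! ### Passing between weighted and unweighted oscillation -/

section WeightedOsc

variable {d : ℕ} {ρ ω f : EuclideanSpace ℝ (Fin d) → ℝ} {β θ p : ℝ}

lemma weightedOsc_le_of_ae_le (hp : 1 ≤ p) (hω : IsWeight ω) {x : EuclideanSpace ℝ (Fin d)}
    {r : ℝ} {M : ℝ≥0∞}
    (hM : ∀ᵐ y ∂volume.restrict (ball x r), lowerOsc f (ball x r) y ≤ M) :
    weightedOsc β p ω f x r ≤ volume (ball x r) ^ (-(β / d)) * M := by
  have hp0 : 0 < p := by linarith
  unfold weightedOsc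
  gcongr
  set W := ∫⁻ y in ball x r, ENNReal.ofReal (ω y)
  have h1 : ∫⁻ y in ball x r, lowerOsc f (ball x r) y ^ p * ENNReal.ofReal (ω y) ≤ M ^ p * W := by
    rw [← lintegral_const_mul'' _ hω.aemeasurable.restrict]
    refine lintegral_mono_ae ?_
    filter_upwards [hM] with y hy
    gcongr
  calc (W⁻¹ * ∫⁻ y in ball x r, lowerOsc f (ball x r) y ^ p * ENNReal.ofReal (ω y)) ^ (1 / p)
      ≤ (W⁻¹ * (M ^ p * W)) ^ (1 / p) := by gcongr
    _ = ((W⁻¹ * W) * M ^ p) ^ (1 / p) := by congr 1; ring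
    -- `W⁻¹ * W ≤ 1` also holds for `W = 0` and `W = ∞`, so no property of `W` is needed.
    _ ≤ (1 * M ^ p) ^ (1 / p) := by
      gcongr
      exact ENNReal.inv_mul_le_one _
    _ = M := by rw [one_mul, ← ENNReal.rpow_mul, mul_one_div_cancel hp0.ne', ENNReal.rpow_one]

lemma MemCampanato.weightedOsc_le (h : MemCampanato ρ β θ f) (hρ : ∀ x, 0 < ρ x) (hd : d ≠ 0)
    (hβ : 0 < β) (hθ : 0 < θ) {C₀ N₀ : ℝ} (hC : IsComparisonPair ρ C₀ N₀) (hp : 1 ≤ p)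
    (hω : IsWeight ω) (x : EuclideanSpace ℝ (Fin d)) {r : ℝ} (hr : 0 < r) :
    weightedOsc β p ω f x r ≤ ENNReal.ofReal (oscConst d β * (4 * C₀) ^ θ * 2 ^ β) *
      ENNReal.ofReal ((1 + r / ρ x) ^ ((N₀ + 1) * θ)) * campanatoConst ρ β θ f := by
  have hK := oscConst_pos d hβ
  have hC1 := hC.1
  have hx := hρ x
  have hB := volumeReal_ball_pos x hr
  have hfin := lintegral_lowerOsc_ne_top hρ h.2 x hr
  set M : ℝ := (oscConst d β * (4 * C₀) ^ θ * 2 ^ β) * (campanatoConst ρ β θ f).toReal *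
    (1 + r / ρ x) ^ ((N₀ + 1) * θ) with hM
  have hM0 : 0 ≤ M := by positivity
  have h1 : ∀ᵐ y ∂volume.restrict (ball x r), lowerOsc f (ball x r) y ≤
      ENNReal.ofReal (M * volume.real (ball x r) ^ (β / d)) := by
    filter_upwards [h.ae_lowerOsc_le hρ hd hβ hθ hC x hr] with y hy
    rw [lowerOsc_ball_eq hr hfin]
    exact ENNReal.ofReal_le_ofReal hy
  refine (weightedOsc_le_of_ae_le hp hω h1).trans_eq ?_
  rw [ENNReal.ofReal_mul hM0, ← ENNReal.ofReal_rpow_of_pos hB, ofReal_measureReal,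
    mul_left_comm, ← ENNReal.rpow_add _ _ (measure_ball_pos volume x hr).ne'
      measure_ball_lt_top.ne, neg_add_cancel, ENNReal.rpow_zero, mul_one, hM,
    ENNReal.ofReal_mul (by positivity), ENNReal.ofReal_mul (by positivity),
    ENNReal.ofReal_toReal h.2.ne]
  ring

lemma IsApWeight.mul_lintegral_lowerOsc_le_weightedOsc (hω : IsApWeight ρ θ p ω) (hp : 1 ≤ p)
    (hf : AEMeasurable f volume) (x : EuclideanSpace ℝ (Fin d)) {r : ℝ} (hr : 0 < r) :
    volume (ball x r) ^ (-(1 + β / d)) * ∫⁻ y in ball x r, lowerOsc f (ball x r) y ≤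
      weightedOsc β p ω f x r * apBallConst p ω x r := by
  have h1 := hω.ballAverage_le hp x hr (aemeasurable_lowerOsc hf (ball x r))
  have h2 : volume (ball x r) ^ (-(1 + β / d)) =
      volume (ball x r) ^ (-(β / d)) * (volume (ball x r))⁻¹ := by
    rw [← ENNReal.rpow_neg_one, ← ENNReal.rpow_add _ _ (measure_ball_pos volume x hr).ne'
      measure_ball_lt_top.ne]
    congr 1; ring
  rw [h2, mul_assoc]
  unfold weightedOsc
  rw [mul_assoc]
  exact mul_le_mul_right h1 _

lemma IsApWeight.campanatoConst_le {θ₁ : ℝ} (hω : IsApWeight ρ θ p ω) (hρ : ∀ x, 0 < ρ x)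
    (hp : 1 ≤ p) (hf : AEMeasurable f volume) {A : ℝ≥0∞}
    (hA : ∀ (x : EuclideanSpace ℝ (Fin d)) (r : ℝ), 0 < r → weightedOsc β p ω f x r ≤
      A * ENNReal.ofReal ((1 + r / ρ x) ^ (θ₁ - θ))) :
    campanatoConst ρ β θ₁ f ≤ A * apCharacteristic ρ θ p ω := by
  refine iSup_le fun x => iSup_le fun r => iSup_le fun hr => ?_
  have hu : 0 < 1 + r / ρ x := by have := hρ x; positivity
  -- What remains of the growth factors, `(1 + r/ρ) ^ (-θ)`, is exactly the normalisation in the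
  -- `A_p` characteristic.
  have hE : ENNReal.ofReal ((1 + r / ρ x) ^ (-θ₁)) * ENNReal.ofReal ((1 + r / ρ x) ^ (θ₁ - θ)) =
      ENNReal.ofReal ((1 + r / ρ x) ^ (-θ)) := by
    rw [← ENNReal.ofReal_mul (by positivity), ← Real.rpow_add hu]
    congr 2; ring
  calc _ ≤ ENNReal.ofReal ((1 + r / ρ x) ^ (-θ₁)) *
        (weightedOsc β p ω f x r * apBallConst p ω x r) :=
        mul_le_mul_right (hω.mul_lintegral_lowerOsc_le_weightedOsc hp hf x hr) _
    _ ≤ ENNReal.ofReal ((1 + r / ρ x) ^ (-θ₁)) *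
        ((A * ENNReal.ofReal ((1 + r / ρ x) ^ (θ₁ - θ))) * apBallConst p ω x r) := by
        gcongr
        exact hA x r hr
    _ = A * (ENNReal.ofReal ((1 + r / ρ x) ^ (-θ)) * apBallConst p ω x r) := by
        rw [← hE]; ring
    _ ≤ _ := by
        gcongr
        exact mul_apBallConst_le ρ θ p ω x hr

lemma memCampanato_of_campanatoConst_lt_top (hρ : ∀ x, 0 < ρ x) (hf : AEMeasurable f volume)
    (h : campanatoConst ρ β θ f < ∞) : MemCampanato ρ β θ f :=
  ⟨fun x => ⟨ball x 1, ball_mem_nhds x one_pos,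
    integrableOn_ball_of_lowerOsc hf one_pos (lintegral_lowerOsc_ne_top hρ h x one_pos)⟩, h⟩

end WeightedOsc

theorem mainTheorem4 (d : ℕ) (hd : 3 ≤ d) (V : EuclideanSpace ℝ (Fin d) → ℝ)
    (hV : IsPotential V) :
    -- comparison constants for the critical radius function exist
    (∃ C₀ N₀ : ℝ, IsComparisonPair (criticalRadius V) C₀ N₀) ∧
    -- part (1), for any choice of these constants
    (∀ C₀ N₀ : ℝ, IsComparisonPair (criticalRadius V) C₀ N₀ →
      ∀ β θ₁ : ℝ, 0 < β → β < 1 → 0 < θ₁ →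
        ∃ C : ℝ, 0 < C ∧
          ∀ p θ₂ : ℝ, 1 ≤ p → 0 < θ₂ →
          ∀ ω : EuclideanSpace ℝ (Fin d) → ℝ, IsApWeight (criticalRadius V) θ₂ p ω →
          ∀ f : EuclideanSpace ℝ (Fin d) → ℝ, MemCampanato (criticalRadius V) β θ₁ f →
          ∀ (x₀ : EuclideanSpace ℝ (Fin d)) (r : ℝ), 0 < r →
            weightedOsc β p ω f x₀ r ≤
              ENNReal.ofReal C * apCharacteristic (criticalRadius V) θ₂ p ω
                * ENNReal.ofReal ((1 + r / criticalRadius V x₀) ^ ((N₀ + 1) * θ₁))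
                * campanatoConst (criticalRadius V) β θ₁ f) ∧
    -- part (2)
    (∀ p θ₂ : ℝ, 1 ≤ p → 0 < θ₂ →
      ∀ ω : EuclideanSpace ℝ (Fin d) → ℝ, IsApWeight (criticalRadius V) θ₂ p ω →
      ∀ β θ₁ : ℝ, 0 < β → β < 1 → 0 < θ₁ →
      ∀ f : EuclideanSpace ℝ (Fin d) → ℝ, AEMeasurable f volume →
      ∀ C : ℝ, 0 < C →
        (∀ (x₀ : EuclideanSpace ℝ (Fin d)) (r : ℝ), 0 < r →
          weightedOsc β p ω f x₀ r ≤
            ENNReal.ofReal C * apCharacteristic (criticalRadius V) θ₂ p ω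
              * ENNReal.ofReal ((1 + r / criticalRadius V x₀) ^ (θ₁ - θ₂))) →
        MemCampanato (criticalRadius V) β θ₁ f ∧
          campanatoConst (criticalRadius V) β θ₁ f ≤
            (ENNReal.ofReal C * apCharacteristic (criticalRadius V) θ₂ p ω)
              * apCharacteristic (criticalRadius V) θ₂ p ω) := by
  have hρ := hV.criticalRadius_pos hd
  refine ⟨hV.exists_isComparisonPair hd, ?_, ?_⟩
  · intro C₀ N₀ hC β θ₁ hβ _ hθ₁
    have hC1 := hC.1
    have hK := oscConst_pos d hβ
    refine ⟨oscConst d β * (4 * C₀) ^ θ₁ * 2 ^ β, by positivity, ?_⟩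
    intro p θ₂ hp _ ω hω f hf x r hr
    refine (hf.weightedOsc_le hρ (by omega) hβ hθ₁ hC hp hω.1 x hr).trans ?_
    gcongr
    -- The bound already holds without the characteristic, which is at least `1`.
    exact le_mul_of_one_le_right' (hω.one_le_apCharacteristic hp)
  · intro p θ₂ hp _ ω hω β θ₁ _ _ _ f hf C _ h
    have h1 := hω.campanatoConst_le hρ hp hf h
    refine ⟨memCampanato_of_campanatoConst_lt_top hρ hf (h1.trans_lt ?_), h1⟩
    have h2 := (hω.apCharacteristic_ne_top hρ).lt_top
    exact ENNReal.mul_lt_top (ENNReal.mul_lt_top ENNReal.ofReal_lt_top h2) h2
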